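/- A graphon is a symmetric Lebesgue-measurable function $W:[0,1]^2\to[0,1]$; its Laplacian is the bounded self-adjoint operator $\mathcal L(W)f(x)=\int_0^1 W(x,y)\,(f(y)-f(x))\,dy$ on $L^2([0,1];\mathbb C)$. $W$ is a ring graphon if $W(x,y)=R(|x-y|)$ for some $1$-periodic function $R$ with values in $[0,1]$. For a symmetric $N\times N$ matrix $A$ let $L(A)=A-\mathrm{Deg}(A)$, where $\mathrm{Deg}(A)$ is the diagonal matrix of the row sums of $A$. Let $\mathrm A_d^N$ be the matrix with entries $W(i/N,j/N)$ for $i\ne j$, $1\le i,j\le N$, and zero diagonal, and let $\mathrm A_r^N=[\xi^N_{i,j}]$ be a random symmetric $\{0,1\}$-valued matrix with zero diagonal whose entries with $i>j$ are independent with $\mathbb P(\xi^N_{i,j}=1)=W(i/N,j/N)$. Put $\mathrm L_d^N=L(\mathrm A_d^N)$ and $\mathrm L_r^N=L(\mathrm A_r^N)$. Eigenvalues of matrices are counted with multiplicity. **Theorem.** For every $\gamma\in(0,\tfrac12)$ there is a constant $C=C(\gamma)>0$ such that the following holds. Let $W$ be an almost everywhere continuous ring graphon and let $\mu\in\mathbb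 R$ be an eigenvalue of $\mathcal L(W)$ of multiplicity $1\le m<\infty$ that is an isolated point of the spectrum of $\mathcal L(W)$. Then there exists $\delta_0>0$ (depending on $W$ and $\mu$) such that for all $\delta\in(0,\delta_0)$ and $\gamma\in(0,\tfrac12)$ there exists $N_0\ge 1$ such that for each $N\ge N_0$: 1. There are exactly $m$ eigenvalues $\lambda_1\ge\dots\ge\lambda_m$ of $\mathrm L_d^N$ with $|\lambda_k/N-\mu|<\delta$. 2. With probability at least $1-2Ne^{-C(\gamma)N^{2\gamma}}$, there are exactly $m$ eigenvalues $\hat\lambda_1\ge\dots\ge\hat\lambda_m$ of $\mathrm L_r^N$ with $|\hat\lambda_k/N-\mu|<\delta$. 3. With probability at least $1-2Ne^{-C(\gamma)N^{2\gamma}}$, the conclusion of 2 holds and moreover, whenever $V=[v_1,\dots,v_m]$ and $\hat V=[\hat v_1,\dots,\hat v_m]$ in $\mathbb R^{N\times m}$ have orthonormal columns satisfying $\mathrm L_d^N v_k=\lambda_k v_k$ and $\mathrm L_r^N\hat v_k=\hat\lambda_k\hat v_k$ for $k=1,\dots,m$, there exists an orthogonal matrix $\hat O\in\mathbb R^{m\times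 m}$ such that $$\|\hat V\hat O-V\|_F\le\frac{\sqrt{8m}}{(\delta_0-\delta)\,N^{1/2-\gamma}},$$ where $\|\cdot\|_F$ is the Frobenius norm. -/

import Mathlib

open MeasureTheory ProbabilityTheory Set
open scoped unitInterval Matrix.Norms.Frobenius

/-- A graphon: a symmetric Lebesgue measurable function `W : [0,1]² → [0,1]`. -/
structure Graphon where
  /-- the underlying function -/
  toFun : I → I → ℝ
  symm : ∀ x y, toFun x y = toFun y x
  mem_Icc : ∀ x y, toFun x y ∈ Icc (0 : ℝ) 1
  aemeasurable : AEMeasurable (fun p : I × I => toFun p.1 p.2) (volume : Measure (I × I))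

namespace Graphon

instance : CoeFun Graphon (fun _ => I → I → ℝ) := ⟨Graphon.toFun⟩

/-- `W` is a ring graphon: `W(x,y) = R(|x - y|)` for a 1-periodic `[0,1]`-valued function `R`. -/
def IsRing (W : Graphon) : Prop :=
  ∃ R : ℝ → ℝ, Function.Periodic R 1 ∧ (∀ z, R z ∈ Icc (0 : ℝ) 1) ∧
    ∀ x y : I, W x y = R |(x : ℝ) - y|

/-- `W` is continuous at almost every point of `[0,1]²`. -/
def IsAEContinuous (W : Graphon) : Prop :=
  ∀ᵐ p : I × I, ContinuousAt (fun q : I × I => W q.1 q.2) p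

/-- The graphon Laplacian on functions: `(𝓛(W) f)(x) = ∫₀¹ W(x,y) (f(y) - f(x)) dy`. -/
noncomputable def laplacianFun (W : Graphon) (f : I → ℂ) (x : I) : ℂ :=
  ∫ y : I, (W x y : ℂ) * (f y - f x)

lemma norm_le_one (W : Graphon) (x y : I) : ‖(W x y : ℂ)‖ ≤ 1 := by
  rw [Complex.norm_real, Real.norm_of_nonneg (W.mem_Icc x y).1]
  exact (W.mem_Icc x y).2

lemma aesm_prod (W : Graphon) :
    AEStronglyMeasurable (fun p : I × I => (W p.1 p.2 : ℂ)) (volume.prod volume) :=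
  (Complex.measurable_ofReal.comp_aemeasurable W.aemeasurable).aestronglyMeasurable

lemma aesm_slice (W : Graphon) :
    ∀ᵐ x : I, AEStronglyMeasurable (fun y : I => (W x y : ℂ)) volume :=
  W.aesm_prod.prodMk_left

lemma integrable_slice (W : Graphon) {f : I → ℂ} (hf : Integrable f) :
    ∀ᵐ x : I, Integrable (fun y : I => (W x y : ℂ) * (f y - f x)) := by
  filter_upwards [W.aesm_slice] with x hx
  exact (hf.sub (integrable_const (f x))).bdd_mul hx (c := 1)
    (Filter.Eventually.of_forall fun y => W.norm_le_one x y)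

lemma norm_laplacianFun_le (W : Graphon) {f : I → ℂ} (hf : Integrable f) (x : I) :
    ‖W.laplacianFun f x‖ ≤ (∫ y, ‖f y‖) + ‖f x‖ := by
  have h1 : ‖W.laplacianFun f x‖ ≤ ∫ y : I, (‖f y‖ + ‖f x‖) := by
    refine norm_integral_le_of_norm_le (hf.norm.add (integrable_const _))
      (Filter.Eventually.of_forall fun y => ?_)
    rw [norm_mul]
    calc _ ≤ 1 * (‖f y‖ + ‖f x‖) :=
          mul_le_mul (W.norm_le_one x y) (norm_sub_le _ _) (norm_nonneg _) zero_le_one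
      _ = _ := one_mul _
  refine h1.trans_eq ?_
  rw [integral_add hf.norm (integrable_const _)]
  simp

lemma aesm_laplacianFun (W : Graphon) {f : I → ℂ} (hf : AEStronglyMeasurable f volume) :
    AEStronglyMeasurable (W.laplacianFun f) volume := by
  have h : AEStronglyMeasurable (fun p : I × I => (W p.1 p.2 : ℂ) * (f p.2 - f p.1))
      (volume.prod volume) := W.aesm_prod.mul (hf.comp_snd.sub hf.comp_fst)
  exact h.integral_prod_right'

lemma memLp_laplacianFun (W : Graphon) {f : I → ℂ} (hf : MemLp f 2 volume) :
    MemLp (W.laplacianFun f) 2 volume := by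
  have hi : Integrable f := hf.integrable (by norm_num)
  refine MemLp.of_le ((memLp_const (∫ y, ‖f y‖)).add hf.norm)
    (W.aesm_laplacianFun hf.1) (Filter.Eventually.of_forall fun x => ?_)
  refine (W.norm_laplacianFun_le hi x).trans ?_
  exact le_abs_self _

/-- The graphon Laplacian `𝓛(W)` as a linear map on `L²([0,1]; ℂ)`. -/
noncomputable def laplacianLin (W : Graphon) :
    Lp ℂ 2 (volume : Measure I) →ₗ[ℂ] Lp ℂ 2 (volume : Measure I) where
  toFun f := (W.memLp_laplacianFun (Lp.memLp f)).toLp _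
  map_add' f g := by
    have hf : Integrable f := (Lp.memLp f).integrable (by norm_num)
    have hg : Integrable g := (Lp.memLp g).integrable (by norm_num)
    rw [← MemLp.toLp_add]
    refine MemLp.toLp_congr _ _ ?_
    have hfg := Lp.coeFn_add f g
    filter_upwards [hfg, W.integrable_slice hf, W.integrable_slice hg] with x hx h1 h2
    rw [Pi.add_apply]
    unfold laplacianFun
    rw [← integral_add h1 h2]
    refine integral_congr_ae ?_
    filter_upwards [hfg] with y hy
    rw [hx, hy]
    simp only [Pi.add_apply]
    ring
  map_smul' c f := by
    rw [RingHom.id_apply, ← MemLp.toLp_const_smul]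
    refine MemLp.toLp_congr _ _ ?_
    have hc := Lp.coeFn_smul c f
    filter_upwards [hc] with x hx
    rw [Pi.smul_apply]
    unfold laplacianFun
    rw [← integral_smul]
    refine integral_congr_ae ?_
    filter_upwards [hc] with y hy
    rw [hx, hy]
    simp only [Pi.smul_apply, smul_eq_mul]
    ring

lemma norm_laplacianLin_le (W : Graphon) (f : Lp ℂ 2 (volume : Measure I)) :
    ‖W.laplacianLin f‖ ≤ 2 * ‖f‖ := by
  have hfm := Lp.memLp f
  have hi : Integrable f := hfm.integrable (by norm_num)
  have h1 : ∫ y, ‖f y‖ ≤ ‖f‖ := by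
    rw [integral_norm_eq_lintegral_enorm hfm.1, Lp.norm_def, ← eLpNorm_one_eq_lintegral_enorm]
    exact ENNReal.toReal_mono (Lp.eLpNorm_ne_top f)
      (eLpNorm_le_eLpNorm_of_exponent_le (by norm_num) hfm.1)
  set c : ℝ := ∫ y, ‖f y‖ with hc
  have hc0 : 0 ≤ c := integral_nonneg fun _ => norm_nonneg _
  have hcm : MemLp (fun _ : I => c) 2 volume := memLp_const c
  have h2 : ‖W.laplacianLin f‖ ≤ ‖hcm.toLp _ + hfm.norm.toLp _‖ := by
    refine Lp.norm_le_norm_of_ae_le ?_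
    filter_upwards [MemLp.coeFn_toLp (W.memLp_laplacianFun hfm),
      Lp.coeFn_add (hcm.toLp _) (hfm.norm.toLp _), MemLp.coeFn_toLp hcm,
      MemLp.coeFn_toLp hfm.norm] with x a b c' d
    change ‖((W.memLp_laplacianFun hfm).toLp _ : I → ℂ) x‖ ≤ _
    rw [a, b, Pi.add_apply, c', d]
    exact (W.norm_laplacianFun_le hi x).trans (le_abs_self _)
  have h3 : ‖hcm.toLp _‖ ≤ c := by
    rw [Lp.norm_toLp, eLpNorm_const _ (by norm_num) (NeZero.ne _)]
    simp [abs_of_nonneg hc0]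
  have h4 : ‖hfm.norm.toLp _‖ = ‖f‖ := by
    rw [Lp.norm_toLp, eLpNorm_norm, Lp.norm_def]
  calc _ ≤ _ := h2
    _ ≤ _ := norm_add_le _ _
    _ ≤ 2 * ‖f‖ := by rw [h4]; linarith

/-- The graphon Laplacian `𝓛(W)` as a bounded operator on `L²([0,1]; ℂ)`. -/
noncomputable def laplacian (W : Graphon) :
    Lp ℂ 2 (volume : Measure I) →L[ℂ] Lp ℂ 2 (volume : Measure I) :=
  W.laplacianLin.mkContinuous 2 W.norm_laplacianLin_le

end Graphon

/-- `μ` is an eigenvalue of `T` of (finite) multiplicity `m ≥ 1` which is an isolated point of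
the spectrum of `T`. -/
structure IsIsolatedEigenvalue {E : Type*} [NormedAddCommGroup E] [NormedSpace ℂ E]
    (T : E →L[ℂ] E) (μ : ℂ) (m : ℕ) : Prop where
  hasEigenvalue : Module.End.HasEigenvalue (T : E →ₗ[ℂ] E) μ
  finiteDimensional : FiniteDimensional ℂ (Module.End.eigenspace (T : E →ₗ[ℂ] E) μ)
  finrank_eq : Module.finrank ℂ (Module.End.eigenspace (T : E →ₗ[ℂ] E) μ) = m
  isolated : ∃ ε > 0, ∀ z ∈ spectrum ℂ T, ‖z - μ‖ < ε → z = μ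

/-- The grid points `1/N, 2/N, …, N/N` of `[0,1]`, indexed by `Fin N = {0, …, N-1}`. -/
noncomputable def gridPoint {N : ℕ} (i : Fin N) : I :=
  ⟨((i : ℝ) + 1) / N, by positivity, by
    have h : ((i : ℕ) : ℝ) + 1 ≤ N := by exact_mod_cast i.isLt
    exact div_le_one_of_le₀ h (Nat.cast_nonneg N)⟩

/-- The combinatorial Laplacian `A - Deg(A)` of a weighted adjacency matrix. -/
def graphLaplacian {N : ℕ} (A : Matrix (Fin N) (Fin N) ℝ) : Matrix (Fin N) (Fin N) ℝ :=
  A - Matrix.diagonal (fun i => ∑ j, A i j)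

/-- The adjacency matrix of the deterministic weighted graph on `N` vertices. -/
noncomputable def Graphon.detAdjacency (W : Graphon) (N : ℕ) : Matrix (Fin N) (Fin N) ℝ :=
  Matrix.of fun i j => if i = j then 0 else W (gridPoint i) (gridPoint j)

/-- `A` is the random adjacency matrix of the random graph on `N` vertices generated by `W`:
symmetric, binary, without loops, the entries below the diagonal being independent with
`P(A i j = 1) = W(i/N, j/N)`. -/
structure Graphon.IsRandomAdjacency (W : Graphon) {N : ℕ} {Ω : Type*} [MeasurableSpace Ω]
    (P : Measure Ω) (A : Ω → Matrix (Fin N) (Fin N) ℝ) : Prop where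
  measurable : ∀ i j, Measurable fun ω => A ω i j
  binary : ∀ ω i j, A ω i j = 0 ∨ A ω i j = 1
  symm : ∀ ω i j, A ω i j = A ω j i
  diag : ∀ ω i, A ω i i = 0
  prob_eq : ∀ i j, j < i →
    P {ω | A ω i j = 1} = ENNReal.ofReal (W (gridPoint i) (gridPoint j))
  indep : iIndepFun (fun (p : {p : Fin N × Fin N // p.2 < p.1}) ω => A ω p.1.1 p.1.2) P

/-- `l 0 ≥ l 1 ≥ … ≥ l (m-1)` are exactly the eigenvalues `t` of the `N × N` matrix `L`, listed
with multiplicity, such that `|t / N - μ| < δ`. -/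
def IsEigenvalueListNear {N m : ℕ} (L : Matrix (Fin N) (Fin N) ℝ) (μ δ : ℝ)
    (l : Fin m → ℝ) : Prop :=
  Antitone l ∧
    Multiset.map l Finset.univ.val = L.charpoly.roots.filter (fun t => |t / N - μ| < δ)

/-- The columns of `V` are orthonormal and the `k`-th one is an eigenvector of `L` for `l k`. -/
def IsOrthonormalEigenmatrix {N m : ℕ} (L : Matrix (Fin N) (Fin N) ℝ) (l : Fin m → ℝ)
    (V : Matrix (Fin N) (Fin m) ℝ) : Prop :=
  V.transpose * V = 1 ∧ ∀ k, L.mulVec (V.col k) = l k • V.col k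

/-! Identify `ℂ^N` with step functions through an isometric embedding `J` into `L²`. The matrix
Laplacian then becomes an integral operator with the sampled kernel, to be compared with `N •
W.laplacian`. If every row of the sampled kernel is within `η` of the row of `W` in `L¹`, the two
operators differ along `J` by at most `N (√η + η)` in norm. The term `√η` comes from the integral
part by Cauchy–Schwarz, and `η` from the degree part. The degree part is a multiplication operator,
so it requires an estimate uniform over the rows. The ring structure provides it: all rows are built
from a single profile `R`, almost everywhere continuous by Fubini, so dominated convergence for one
integral over `[0,1]` controls every row (`eventually_lintegral_edist_detAdjacency_le`).

Isolation of `μ` yields, by functional calculus, a spectral gap on the orthogonal complement of the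
eigenspace `E`. Two injectivity arguments then show that the matrix has exactly `dim E` eigenvalues
in the window (`IsEigenbasis.card_filter_eq`). A combination of nearby eigenvectors whose image
under `J` is orthogonal to `E` contradicts the gap. A vector of `E` whose pullback by the adjoint of
`J` has no component near `μ` contradicts approximate intertwining, because that adjoint is bounded
below on the finite-dimensional space `E` for large `N`. The count tolerates a further perturbation
of size `ρ N`.

Hoeffding's inequality on a fine grid of vectors, with a union bound, puts the random Laplacian
within `N^(1/2+γ)` of the deterministic one in operator norm, outside an event of the allowed
probability. As `N^(1/2+γ) = o(N)`, the same count applies to it. For eigenvectors, counting also in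
a larger window shows that no random eigenvalue lies between the two radii. A `sin Θ` estimate then
compares the spectral subspaces, and a polar decomposition produces the orthogonal matrix. -/

/-! ### Spectral estimates for diagonalized operators and the `sin Θ` bound. -/

section Eigenbasis

variable {𝕜 V ι : Type*} [RCLike 𝕜] [NormedAddCommGroup V] [InnerProductSpace 𝕜 V] [Fintype ι]

/-- `b` diagonalizes the operator `S`, with real eigenvalues `e`. -/
def IsEigenbasis (S : V →ₗ[𝕜] V) (b : OrthonormalBasis ι 𝕜 V) (e : ι → ℝ) : Prop :=
  ∀ i, S (b i) = (e i : 𝕜) • b i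

variable {S : V →ₗ[𝕜] V} {b : OrthonormalBasis ι 𝕜 V} {e : ι → ℝ}

namespace IsEigenbasis

lemma inner_apply (h : IsEigenbasis S b e) (i : ι) (v : V) :
    inner 𝕜 (b i) (S v) = (e i : 𝕜) * inner 𝕜 (b i) v := by
  classical
  conv_lhs => rw [← b.sum_repr' v, map_sum, inner_sum]
  simp_rw [map_smul, h _, inner_smul_right, OrthonormalBasis.inner_eq_ite]
  simp [mul_comm]

lemma inner_apply_left (h : IsEigenbasis S b e) (v w : V) :
    inner 𝕜 (S v) w = inner 𝕜 v (S w) := by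
  rw [← b.sum_inner_mul_inner, ← b.sum_inner_mul_inner]
  refine Finset.sum_congr rfl fun i _ => ?_
  rw [h.inner_apply, ← inner_conj_symm, h.inner_apply, map_mul, inner_conj_symm,
    RCLike.conj_ofReal]
  ring

lemma inner_apply_sub (h : IsEigenbasis S b e) (i : ι) (v : V) (ν : ℝ) :
    inner 𝕜 (b i) (S v - (ν : 𝕜) • v) = ((e i - ν : ℝ) : 𝕜) * inner 𝕜 (b i) v := by
  rw [inner_sub_right, h.inner_apply, inner_smul_right]
  push_cast
  ring

lemma sq_norm_apply_sub (h : IsEigenbasis S b e) (v : V) (ν : ℝ) :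
    ‖S v - (ν : 𝕜) • v‖ ^ 2 = ∑ i, |e i - ν| ^ 2 * ‖inner 𝕜 (b i) v‖ ^ 2 := by
  rw [← b.sum_sq_norm_inner_right]
  refine Finset.sum_congr rfl fun i _ => ?_
  rw [h.inner_apply_sub, norm_mul, RCLike.norm_ofReal, mul_pow]

/-- An upper bound for `S - ν` on the part of the space where the eigenvalues are close to `ν`. -/
lemma norm_apply_sub_le (h : IsEigenbasis S b e) {v : V} {ν r : ℝ} (hr : 0 ≤ r)
    (hv : ∀ i, inner 𝕜 (b i) v ≠ 0 → |e i - ν| ≤ r) : ‖S v - (ν : 𝕜) • v‖ ≤ r * ‖v‖ := by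
  refine le_of_sq_le_sq ?_ (by positivity)
  rw [h.sq_norm_apply_sub, mul_pow, ← b.sum_sq_norm_inner_right v, Finset.mul_sum]
  refine Finset.sum_le_sum fun i _ => ?_
  by_cases hi : inner 𝕜 (b i) v = 0
  · simp [hi]
  · have := hv i hi
    gcongr

/-- A lower bound for `S - ν` in terms of the part of the vector away from `ν`. -/
lemma mul_norm_le_norm_apply_sub (h : IsEigenbasis S b e) {v w : V} {ν r : ℝ} (hr : 0 ≤ r)
    (hw : ∀ i, inner 𝕜 (b i) w ≠ 0 → inner 𝕜 (b i) w = inner 𝕜 (b i) v ∧ r ≤ |e i - ν|) :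
    r * ‖w‖ ≤ ‖S v - (ν : 𝕜) • v‖ := by
  refine le_of_sq_le_sq ?_ (norm_nonneg _)
  rw [h.sq_norm_apply_sub, mul_pow, ← b.sum_sq_norm_inner_right w, Finset.mul_sum]
  refine Finset.sum_le_sum fun i _ => ?_
  by_cases hi : inner 𝕜 (b i) w = 0
  · rw [hi, norm_zero, zero_pow two_ne_zero, mul_zero]
    positivity
  · obtain ⟨h1, h2⟩ := hw i hi
    rw [h1]
    gcongr

/-- Eigenvectors of a diagonalized operator are orthogonal to basis vectors with a different
eigenvalue. -/
lemma inner_eq_zero_of_ne (h : IsEigenbasis S b e) {v : V} {l : ℝ} (hv : S v = (l : 𝕜) • v)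
    {i : ι} (hi : e i ≠ l) : inner 𝕜 (b i) v = 0 := by
  have h1 := h.inner_apply_sub i v l
  rw [hv, sub_self, inner_zero_right, eq_comm, mul_eq_zero] at h1
  refine h1.resolve_left ?_
  exact_mod_cast sub_ne_zero.2 hi

end IsEigenbasis

/-- Orthonormal eigenvectors `v'` for eigenvalues in a window that has as many eigenvalues as there
are vectors: a vector orthogonal to all of them is orthogonal to the whole spectral subspace. -/
lemma IsEigenbasis.inner_eq_zero_of_forall_inner_eq_zero (h : IsEigenbasis S b e) {m : ℕ}
    {ν r : ℝ} (hcard : (Finset.univ.filter fun i => |e i - ν| < r).card = m)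
    {v' : Fin m → V} (hv' : Orthonormal 𝕜 v') {l : Fin m → ℝ}
    (hl : ∀ k, S (v' k) = (l k : 𝕜) • v' k) (hlr : ∀ k, |l k - ν| < r)
    {w : V} (hw : ∀ k, inner 𝕜 (v' k) w = 0) {i : ι} (hi : |e i - ν| < r) :
    inner 𝕜 (b i) w = 0 := by
  classical
  set s := Finset.univ.filter fun i => |e i - ν| < r with hs
  set F := Submodule.span 𝕜 (s.image b : Set V) with hF
  have hle : Submodule.span 𝕜 (Set.range v') ≤ F := by
    rw [Submodule.span_le]
    rintro _ ⟨k, rfl⟩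
    rw [SetLike.mem_coe, ← b.sum_repr' (v' k)]
    refine Submodule.sum_mem _ fun i _ => ?_
    by_cases hi : |e i - ν| < r
    · refine Submodule.smul_mem _ _ (Submodule.subset_span ?_)
      simpa using ⟨i, by simpa [hs] using hi, rfl⟩
    · rw [h.inner_eq_zero_of_ne (hl k), zero_smul]
      · exact zero_mem _
      · rintro heq
        exact hi (heq ▸ hlr k)
  have : FiniteDimensional 𝕜 F := FiniteDimensional.span_finset 𝕜 _
  -- The span of the `v' k` lies in the spectral subspace `F`, whose dimension is at most `m`;
  -- having dimension `m`, it fills `F`.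
  have heq : Submodule.span 𝕜 (Set.range v') = F := by
    refine Submodule.eq_of_le_of_finrank_le hle ?_
    rw [finrank_span_eq_card hv'.linearIndependent, Fintype.card_fin, ← hcard]
    exact (finrank_span_finset_le_card _).trans Finset.card_image_le
  have hb : b i ∈ Submodule.span 𝕜 (Set.range v') := by
    rw [heq]
    refine Submodule.subset_span ?_
    simpa using ⟨i, by simpa [hs] using hi, rfl⟩
  have hsp : Submodule.span 𝕜 (Set.range v') ≤ (𝕜 ∙ w)ᗮ := by
    rw [Submodule.span_le]
    rintro _ ⟨k, rfl⟩
    rw [SetLike.mem_coe, Submodule.mem_orthogonal_singleton_iff_inner_left]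
    exact hw k
  exact Submodule.mem_orthogonal_singleton_iff_inner_left.1 (hsp hb)

/-- The `sin Θ` theorem: the part of an approximate eigenvector `v` orthogonal to a spectral
subspace is controlled by the spectral gap. -/
lemma IsEigenbasis.mul_norm_sub_le (h : IsEigenbasis S b e) {m : ℕ}
    {ν r r' : ℝ} (hcard : (Finset.univ.filter fun i => |e i - ν| < r').card = m)
    {v' : Fin m → V} (hv' : Orthonormal 𝕜 v') {l : Fin m → ℝ}
    (hl : ∀ k, S (v' k) = (l k : 𝕜) • v' k) (hlr : ∀ k, |l k - ν| < r')
    {lam : ℝ} (hlam : |lam - ν| ≤ r) (hr : r ≤ r') (v : V) :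
    (r' - r) * ‖v - ∑ k, inner 𝕜 (v' k) v • v' k‖ ≤ ‖S v - (lam : 𝕜) • v‖ := by
  refine h.mul_norm_le_norm_apply_sub (sub_nonneg.2 hr) fun i hi => ?_
  have horth : ∀ j, inner 𝕜 (v' j) (v - ∑ k, inner 𝕜 (v' k) v • v' k) = 0 := by
    intro j
    rw [inner_sub_right, hv'.inner_right_fintype, sub_self]
  -- The residual has no coordinates inside the window, and outside it the distance from `e i` to
  -- `lam` is at least `r' - r`.
  have hfar : r' ≤ |e i - ν| := by
    by_contra! hlt
    exact hi (h.inner_eq_zero_of_forall_inner_eq_zero hcard hv' hl hlr horth hlt)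
  constructor
  · rw [inner_sub_right, inner_sum, Finset.sum_eq_zero, sub_zero]
    intro k _
    rw [inner_smul_right, h.inner_eq_zero_of_ne (hl k), mul_zero]
    rintro heq
    exact absurd (hlr k) (by rw [← heq]; exact hfar.not_gt)
  · have : |e i - ν| ≤ |e i - lam| + |lam - ν| := by
      have := abs_add_le (e i - lam) (lam - ν)
      rwa [sub_add_sub_cancel] at this
    linarith

end Eigenbasis

/-! ### Eigenvalue lists and orthogonal alignment of frames. -/

section Matrix

open Matrix

/-- The eigenvector basis of a Hermitian matrix diagonalizes the associated operator. -/
lemma Matrix.IsHermitian.isEigenbasis {𝕜 n : Type*} [RCLike 𝕜] [Fintype n] [DecidableEq n]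
    {A : Matrix n n 𝕜} (hA : A.IsHermitian) :
    IsEigenbasis (Matrix.toLpLin 2 2 A) hA.eigenvectorBasis hA.eigenvalues := by
  intro i
  rw [toLpLin_apply, hA.mulVec_eigenvectorBasis]
  ext j
  simp [RCLike.real_smul_eq_coe_mul]

lemma Matrix.IsHermitian.roots_charpoly_real {n : Type*} [Fintype n] [DecidableEq n]
    {A : Matrix n n ℝ} (hA : A.IsHermitian) :
    A.charpoly.roots = Multiset.map hA.eigenvalues Finset.univ.val := by
  simpa using hA.roots_charpoly_eq_eigenvalues

/-- A real symmetric matrix and its complexification have the same eigenvalues. -/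
lemma Matrix.IsHermitian.roots_charpoly_eq_map_ofReal {n : Type*} [Fintype n] [DecidableEq n]
    {A : Matrix n n ℝ} (hA : A.IsHermitian) (hA' : (A.map (algebraMap ℝ ℂ)).IsHermitian) :
    A.charpoly.roots = Multiset.map hA'.eigenvalues Finset.univ.val := by
  have h1 := hA'.roots_charpoly_eq_eigenvalues
  rw [Matrix.charpoly_map, hA.splits_charpoly.roots_map] at h1
  refine Multiset.map_injective (f := ((↑) : ℝ → ℂ)) Complex.ofReal_injective ?_
  rw [Multiset.map_map]
  exact h1

lemma card_filter_eigenvalues {n : Type*} [Fintype n] {e : n → ℝ} {A : Multiset ℝ}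
    (h : A = Multiset.map e Finset.univ.val) (p : ℝ → Prop) [DecidablePred p] :
    (A.filter p).card = (Finset.univ.filter fun i => p (e i)).card := by
  rw [h, Multiset.filter_map, Multiset.card_map, ← Finset.filter_val, Finset.card_val]
  rfl

lemma exists_antitone_of_card_eq {m : ℕ} (s : Multiset ℝ) (hs : s.card = m) :
    ∃ l : Fin m → ℝ, Antitone l ∧ Multiset.map l Finset.univ.val = s := by
  obtain ⟨t, rfl, ht⟩ : ∃ t : List ℝ, (t : Multiset ℝ) = s ∧ t.Pairwise (· ≥ ·) :=
    ⟨s.sort (· ≥ ·), s.sort_eq _, s.pairwise_sort _⟩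
  rw [Multiset.coe_card] at hs
  subst hs
  refine ⟨t.get, fun i j hij => ht.rel_get_of_le hij, ?_⟩
  rw [Fin.univ_val_map, List.ofFn_get]

lemma IsEigenvalueListNear.abs_sub_lt {N m : ℕ} {L : Matrix (Fin N) (Fin N) ℝ} {μ δ : ℝ}
    {l : Fin m → ℝ} (h : IsEigenvalueListNear L μ δ l) (k : Fin m) : |l k / N - μ| < δ := by
  have : l k ∈ Multiset.map l Finset.univ.val := Multiset.mem_map_of_mem _ (Finset.mem_univ_val k)
  rw [h.2] at this
  exact (Multiset.mem_filter.1 this).2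

lemma exists_isEigenvalueListNear {N m : ℕ} {L : Matrix (Fin N) (Fin N) ℝ} {μ δ : ℝ}
    (h : (L.charpoly.roots.filter fun t => |t / N - μ| < δ).card = m) :
    ∃ l : Fin m → ℝ, IsEigenvalueListNear L μ δ l :=
  exists_antitone_of_card_eq _ h

lemma dotProduct_self_nonneg_real {n : Type*} [Fintype n] (x : n → ℝ) : 0 ≤ x ⬝ᵥ x :=
  Finset.sum_nonneg fun i _ => mul_self_nonneg (x i)

lemma trace_transpose_mul_self {n k : Type*} [Fintype n] [Fintype k] (A : Matrix n k ℝ) :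
    (Aᵀ * A).trace = ∑ j, ∑ i, A i j ^ 2 := by
  simp [Matrix.trace, Matrix.mul_apply, sq]

lemma sq_frobenius_norm {n k : Type*} [Fintype n] [Fintype k] (A : Matrix n k ℝ) :
    ‖A‖ ^ 2 = (Aᵀ * A).trace := by
  rw [trace_transpose_mul_self, Finset.sum_comm, Matrix.frobenius_norm_def, ← Real.rpow_natCast,
    ← Real.rpow_mul (by positivity)]
  simp

/-- A contraction that is injective can be replaced by an orthogonal matrix at the cost measured by
its defect from being an isometry. -/
lemma exists_orthogonal_trace_le {m : ℕ} (G : Matrix (Fin m) (Fin m) ℝ)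
    (h0 : ∀ x, G *ᵥ x = 0 → x = 0) (h1 : ∀ x, (G *ᵥ x) ⬝ᵥ (G *ᵥ x) ≤ x ⬝ᵥ x) :
    ∃ O ∈ Matrix.orthogonalGroup (Fin m) ℝ, (Gᵀ * G).trace ≤ (Oᵀ * G).trace := by
  have hH : (Gᵀ * G).IsHermitian := by
    simpa [conjTranspose_eq_transpose_of_trivial] using isHermitian_conjTranspose_mul_self G
  set d := hH.eigenvalues with hd
  set U : Matrix (Fin m) (Fin m) ℝ := (hH.eigenvectorUnitary).1 with hU
  have hUU : Uᵀ * U = 1 := by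
    simpa [star_eq_conjTranspose, conjTranspose_eq_transpose_of_trivial] using
      Unitary.coe_star_mul_self hH.eigenvectorUnitary
  have hUU' : U * Uᵀ = 1 := mul_eq_one_comm.1 hUU
  have hspec : Gᵀ * G = U * diagonal d * Uᵀ := by
    have := hH.spectral_theorem
    rw [Unitary.conjStarAlgAut_apply] at this
    simpa [star_eq_conjTranspose, conjTranspose_eq_transpose_of_trivial, Function.comp_def]
      using this
  have hunit : ∀ i, (U.col i) ⬝ᵥ (U.col i) = 1 := by
    intro i
    have := congrFun (congrFun hUU i) i
    simpa [Matrix.mul_apply, dotProduct] using this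
  have hdi : ∀ i, d i = (G *ᵥ U.col i) ⬝ᵥ (G *ᵥ U.col i) := by
    intro i
    have h := hH.mulVec_eigenvectorBasis i
    rw [← hH.eigenvectorUnitary_col_eq i, ← hU, ← hd] at h
    rw [Matrix.dotProduct_mulVec, ← Matrix.mulVec_transpose, Matrix.mulVec_mulVec, h,
      smul_dotProduct, hunit, smul_eq_mul, mul_one]
  have hpos : ∀ i, 0 < d i := by
    intro i
    rw [hdi]
    refine lt_of_le_of_ne (dotProduct_self_nonneg_real _) fun h => ?_
    have hz := h0 _ (dotProduct_self_eq_zero.1 h.symm)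
    have := hunit i
    rw [hz] at this
    simp at this
  have hle : ∀ i, d i ≤ 1 := fun i => (hdi i).trans_le ((h1 _).trans_eq (hunit i))
  -- The orthogonal matrix is the polar factor `G (GᵀG)^(-1/2)`. Its transpose times `G` is
  -- `(GᵀG)^(1/2)`, and `d ≤ √d` on `(0, 1]` gives the trace inequality.
  set D : Matrix (Fin m) (Fin m) ℝ := diagonal fun i => (√(d i))⁻¹ with hD
  have hDt : Dᵀ = D := diagonal_transpose _
  have hDd : D * diagonal d = diagonal fun i => √(d i) := by
    rw [hD, diagonal_mul_diagonal]
    congr 1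
    ext i
    have := Real.sq_sqrt (hpos i).le
    have h2 := Real.sqrt_pos.2 (hpos i)
    field_simp
    linarith
  have hDdD : (diagonal fun i => √(d i)) * D = 1 := by
    rw [hD, diagonal_mul_diagonal, ← diagonal_one]
    congr 1
    ext i
    exact mul_inv_cancel₀ (Real.sqrt_pos.2 (hpos i)).ne'
  refine ⟨G * (U * D * Uᵀ), ?_, ?_⟩
  · rw [Matrix.mem_orthogonalGroup_iff']
    have : (G * (U * D * Uᵀ))ᵀ = U * D * Uᵀ * Gᵀ := by
      simp [transpose_mul, hDt, Matrix.mul_assoc]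
    rw [this]
    calc U * D * Uᵀ * Gᵀ * (G * (U * D * Uᵀ)) = U * D * Uᵀ * (Gᵀ * G) * (U * D * Uᵀ) := by
          simp only [Matrix.mul_assoc]
      _ = U * D * (Uᵀ * U) * diagonal d * (Uᵀ * U) * D * Uᵀ := by
          rw [hspec]; simp only [Matrix.mul_assoc]
      _ = U * (D * diagonal d * D) * Uᵀ := by
          rw [hUU]; simp only [Matrix.mul_assoc, Matrix.mul_one]
      _ = 1 := by rw [hDd, hDdD, Matrix.mul_one, hUU']
  · have h3 : (G * (U * D * Uᵀ))ᵀ * G = U * (D * diagonal d) * Uᵀ := by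
      calc (G * (U * D * Uᵀ))ᵀ * G = U * D * Uᵀ * (Gᵀ * G) := by
            simp [transpose_mul, hDt, Matrix.mul_assoc]
        _ = U * D * (Uᵀ * U) * diagonal d * Uᵀ := by
            rw [hspec]; simp only [Matrix.mul_assoc]
        _ = _ := by rw [hUU]; simp only [Matrix.mul_assoc, Matrix.one_mul]
    rw [h3, hDd, hspec, trace_mul_cycle, trace_mul_cycle U, hUU, Matrix.one_mul, Matrix.one_mul,
      trace_diagonal, trace_diagonal]
    refine Finset.sum_le_sum fun i _ => ?_
    exact Real.le_sqrt_of_sq_le (by nlinarith [hpos i, hle i])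

/-- Two matrices with orthonormal columns whose column spaces are close are close up to an
orthogonal change of columns. -/
lemma exists_orthogonal_norm_sub_le {N m : ℕ} {V V' : Matrix (Fin N) (Fin m) ℝ}
    (hV : Vᵀ * V = 1) (hV' : V'ᵀ * V' = 1) {θ : ℝ} (hθ0 : 0 ≤ θ) (hsmall : m * θ ^ 2 < 1)
    (hθ : ∀ k, ∑ i, (V - V' * (V'ᵀ * V)) i k ^ 2 ≤ θ ^ 2) :
    ∃ O ∈ Matrix.orthogonalGroup (Fin m) ℝ, ‖V' * O - V‖ ≤ √(2 * m) * θ := by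
  set G := V'ᵀ * V with hG
  set X := V - V' * G with hX
  have hXX : Xᵀ * X = 1 - Gᵀ * G := by
    calc Xᵀ * X = Vᵀ * V - (Vᵀ * V') * G - Gᵀ * (V'ᵀ * V) + Gᵀ * (V'ᵀ * V') * G := by
          rw [hX]
          simp only [transpose_sub, transpose_mul, Matrix.sub_mul, Matrix.mul_sub,
            Matrix.mul_assoc]
          abel
      _ = 1 - Gᵀ * G := by
          have : Vᵀ * V' = Gᵀ := by rw [hG, transpose_mul, transpose_transpose]
          rw [this, ← hG, hV, hV', Matrix.mul_one]
          abel
  have htr : (Xᵀ * X).trace ≤ m * θ ^ 2 := by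
    rw [trace_transpose_mul_self]
    refine (Finset.sum_le_sum fun k _ => hθ k).trans_eq ?_
    simp
  have hdot : ∀ x, (X *ᵥ x) ⬝ᵥ (X *ᵥ x) = x ⬝ᵥ x - (G *ᵥ x) ⬝ᵥ (G *ᵥ x) := by
    intro x
    rw [Matrix.dotProduct_mulVec, ← Matrix.mulVec_transpose, Matrix.mulVec_mulVec, hXX,
      Matrix.sub_mulVec, sub_dotProduct, Matrix.one_mulVec,
      Matrix.dotProduct_mulVec (G *ᵥ x), ← Matrix.mulVec_transpose, Matrix.mulVec_mulVec]
  -- With `hdot`, a kernel vector `x` of `G` would satisfy `|x|² = |X x|² ≤ m θ² |x|²`; smallness of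
  -- `m θ²` therefore makes `G` injective.
  have hcs : ∀ x, (X *ᵥ x) ⬝ᵥ (X *ᵥ x) ≤ m * θ ^ 2 * (x ⬝ᵥ x) := by
    intro x
    refine le_trans ?_ (mul_le_mul_of_nonneg_right htr (dotProduct_self_nonneg_real x))
    rw [trace_transpose_mul_self, Finset.sum_comm, Finset.sum_mul]
    refine Finset.sum_le_sum fun i _ => ?_
    rw [← sq]
    refine (Finset.sum_mul_sq_le_sq_mul_sq Finset.univ (fun k => X i k) x).trans_eq ?_
    simp [dotProduct, sq]
  obtain ⟨O, hO, htrO⟩ := exists_orthogonal_trace_le G (fun x hx => by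
      have h1 := hdot x
      have h2 := hcs x
      rw [hx, dotProduct_zero, sub_zero] at h1
      have h3 := dotProduct_self_nonneg_real x
      exact dotProduct_self_eq_zero.1 (by nlinarith)) (fun x => by
      have := dotProduct_self_nonneg_real (X *ᵥ x)
      linarith [hdot x])
  refine ⟨O, hO, le_of_sq_le_sq ?_ (by positivity)⟩
  have hOO : Oᵀ * O = 1 := (Matrix.mem_orthogonalGroup_iff' _ _).1 hO
  have hexp : (V' * O - V)ᵀ * (V' * O - V) = 1 - Oᵀ * G - (Oᵀ * G)ᵀ + 1 := by
    calc (V' * O - V)ᵀ * (V' * O - V)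
        = Oᵀ * (V'ᵀ * V') * O - Oᵀ * (V'ᵀ * V) - (Vᵀ * V') * O + Vᵀ * V := by
          simp only [transpose_sub, transpose_mul, Matrix.sub_mul, Matrix.mul_sub,
            Matrix.mul_assoc]
          abel
      _ = _ := by
          rw [hV, hV', Matrix.mul_one, hOO, hG]
          simp only [transpose_mul, transpose_transpose]
  have htr1 : (1 : Matrix (Fin m) (Fin m) ℝ).trace = m := by simp
  have htr2 : (Xᵀ * X).trace = m - (Gᵀ * G).trace := by rw [hXX, trace_sub, htr1]
  -- The squared distance is `2m - 2 tr(OᵀG) ≤ 2(m - tr(GᵀG)) = 2 tr(XᵀX)`.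
  rw [sq_frobenius_norm, hexp, trace_add, trace_sub, trace_sub, trace_transpose, htr1, mul_pow,
    Real.sq_sqrt (by positivity)]
  linarith

end Matrix

/-! ### The spectral gap around an isolated eigenvalue. -/

section Gap

variable {H : Type*} [NormedAddCommGroup H] [InnerProductSpace ℂ H] [CompleteSpace H]

/-- On the orthogonal complement of the eigenspace of an eigenvalue isolated in the spectrum, a
self-adjoint operator is bounded away from that eigenvalue. -/
lemma IsSelfAdjoint.mul_norm_le_norm_apply_sub {T : H →L[ℂ] H} (hT : IsSelfAdjoint T) {μ : ℂ}
    {ε : ℝ} (hε : 0 < ε) (hiso : ∀ z ∈ spectrum ℂ T, ‖z - μ‖ < ε → z = μ) {f : H}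
    (hf : f ∈ (Module.End.eigenspace (T : H →ₗ[ℂ] H) μ)ᗮ) :
    ε * ‖f‖ ≤ ‖T f - μ • f‖ := by
  classical
  have hn : IsStarNormal T := hT.isStarNormal
  -- Isolation makes the value at `μ` irrelevant for continuity on the spectrum, so the functional
  -- calculus accepts the following discontinuous functions.
  have hcont : ∀ g : ℂ → ℂ, ContinuousOn g {μ}ᶜ → ContinuousOn g (spectrum ℂ T) := by
    intro g hg z hz
    by_cases hzμ : z = μ
    · subst hzμ
      have h1 : ContinuousWithinAt g {z} z := continuousWithinAt_singleton
      refine h1.mono_of_mem_nhdsWithin ?_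
      rw [Metric.mem_nhdsWithin_iff]
      exact ⟨ε, hε, fun w hw => hiso w hw.2 (by simpa [dist_eq_norm] using hw.1)⟩
    · exact (hg.continuousAt (isOpen_compl_singleton.mem_nhds hzμ)).continuousWithinAt
  -- `p` gives the spectral projection at `μ` and `g` the reduced resolvent; they are linked by
  -- `g(T)(T - μ) + p(T) = 1`.
  set p : ℂ → ℂ := fun z => if z = μ then 1 else 0 with hp
  set g : ℂ → ℂ := fun z => if z = μ then 0 else (z - μ)⁻¹ with hg
  have hpc : ContinuousOn p (spectrum ℂ T) := by
    refine hcont p ((continuousOn_const (c := (0 : ℂ))).congr fun z hz => ?_)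
    exact if_neg hz
  have hgc : ContinuousOn g (spectrum ℂ T) := by
    refine hcont g (ContinuousOn.congr (f := fun z : ℂ => (z - μ)⁻¹) ?_ fun z hz => ?_)
    · exact ContinuousOn.inv₀ (by fun_prop) fun z hz => sub_ne_zero.2 hz
    · exact if_neg hz
  have hTc : ContinuousOn (fun z : ℂ => z - μ) (spectrum ℂ T) := by fun_prop
  have hTμ : cfc (fun z : ℂ => z - μ) T = T - algebraMap ℂ (H →L[ℂ] H) μ := by
    rw [cfc_sub (fun z : ℂ => z) (fun _ : ℂ => μ) T, cfc_id' ℂ T, cfc_const μ T]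
  have hTf : ∀ x, cfc (fun z : ℂ => z - μ) T x = T x - μ • x := by
    intro x
    rw [hTμ, sub_apply, Algebra.algebraMap_eq_smul_one]
    rfl
  have hP0 : cfc (fun z : ℂ => z - μ) T * cfc p T = 0 := by
    rw [← cfc_mul _ _ T hTc hpc, ← cfc_zero ℂ T]
    refine cfc_congr fun z _ => ?_
    by_cases hz : z = μ <;> simp [hp, hz]
  have hGT : cfc g T * cfc (fun z : ℂ => z - μ) T + cfc p T = 1 := by
    rw [← cfc_mul _ _ T hgc hTc, ← cfc_add T (fun z => g z * (z - μ)) p (hgc.mul hTc) hpc,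
      ← cfc_one ℂ T]
    refine cfc_congr fun z _ => ?_
    by_cases hz : z = μ
    · simp [hp, hg, hz]
    · simp [hp, hg, hz, sub_ne_zero.2 hz]
  have hPP : cfc p T * cfc p T = cfc p T := by
    rw [← cfc_mul _ _ T hpc hpc]
    refine cfc_congr fun z _ => ?_
    by_cases hz : z = μ <;> simp [hp, hz]
  have hPs : star (cfc p T) = cfc p T := by
    rw [← cfc_star]
    refine cfc_congr fun z _ => ?_
    by_cases hz : z = μ <;> simp [hp, hz]
  have hG : ‖cfc g T‖ ≤ ε⁻¹ := by
    refine norm_cfc_le (by positivity) fun z hz => ?_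
    by_cases hzμ : z = μ
    · simp [hg, hzμ, hε.le]
    · simp only [hg, hzμ, if_false, norm_inv]
      exact inv_anti₀ hε (not_lt.1 fun h => hzμ (hiso z hz h))
  have hPf : cfc p T f = 0 := by
    have hmem : cfc p T f ∈ Module.End.eigenspace (T : H →ₗ[ℂ] H) μ := by
      rw [Module.End.mem_eigenspace_iff, ContinuousLinearMap.coe_coe, ← sub_eq_zero, ← hTf,
        ← mul_apply_eq_comp, hP0, zero_apply]
    rw [← inner_self_eq_zero (𝕜 := ℂ)]
    conv_lhs => rw [← ContinuousLinearMap.adjoint_inner_right,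
      ← ContinuousLinearMap.star_eq_adjoint,
      hPs, ← mul_apply_eq_comp, hPP]
    exact Submodule.inner_left_of_mem_orthogonal hmem hf
  have hfe : f = cfc g T (T f - μ • f) := by
    have := congrArg (fun S : H →L[ℂ] H => S f) hGT
    simp only [add_apply, mul_apply_eq_comp, hPf, hTf, add_zero,
      one_apply_eq_self] at this
    exact this.symm
  have : ‖f‖ ≤ ε⁻¹ * ‖T f - μ • f‖ := by
    calc ‖f‖ = ‖cfc g T (T f - μ • f)‖ := by rw [← hfe]
      _ ≤ ‖cfc g T‖ * ‖T f - μ • f‖ := ContinuousLinearMap.le_opNorm _ _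
      _ ≤ _ := by gcongr
  rwa [inv_mul_eq_div, le_div_iff₀' hε] at this

end Gap

/-! ### Counting eigenvalues through an approximate intertwining. -/

section Counting

variable {𝕜 V H ι : Type*} [RCLike 𝕜] [NormedAddCommGroup V] [InnerProductSpace 𝕜 V]
  [CompleteSpace V] [NormedAddCommGroup H] [InnerProductSpace 𝕜 H] [CompleteSpace H] [Fintype ι]
  {S : V →ₗ[𝕜] V} {b : OrthonormalBasis ι 𝕜 V} {e : ι → ℝ} {T : H →L[𝕜] H} {J : V →L[𝕜] H}
  {E : Submodule 𝕜 H} {ν r η g : ℝ}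

-- The operator estimated here is the adjoint of `J S - T J`, since `S` and `T` are symmetric.
-- Pairing the vector `w` with itself transfers the bound.
open ContinuousLinearMap in
lemma IsEigenbasis.norm_apply_adjoint_sub_le (h : IsEigenbasis S b e) (hT : IsSelfAdjoint T)
    (hη : ∀ v, ‖T (J v) - J (S v)‖ ≤ η * ‖v‖) (hη0 : 0 ≤ η) (f : H) :
    ‖S (adjoint J f) - adjoint J (T f)‖ ≤ η * ‖f‖ := by
  set w := S (adjoint J f) - adjoint J (T f) with hw
  have key : inner 𝕜 w w = inner 𝕜 (J (S w) - T (J w)) f := by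
    conv_lhs => rw [hw, inner_sub_right, ← hw]
    rw [← h.inner_apply_left, adjoint_inner_right, adjoint_inner_right, inner_sub_left,
      ← adjoint_inner_right T, hT.adjoint_eq]
  have h1 : ‖w‖ ^ 2 ≤ η * ‖w‖ * ‖f‖ := by
    calc ‖w‖ ^ 2 = ‖inner 𝕜 w w‖ := by rw [inner_self_eq_norm_sq_to_K]; simp
      _ ≤ ‖J (S w) - T (J w)‖ * ‖f‖ := by rw [key]; exact norm_inner_le_norm _ _
      _ ≤ η * ‖w‖ * ‖f‖ := by
          rw [norm_sub_rev]
          gcongr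
          exact hη w
  rcases (norm_nonneg w).eq_or_lt with h0 | h0
  · rw [← h0]
    positivity
  · nlinarith

/-- If `S` is close to the self-adjoint operator `T` along the isometric embedding `J`, then it has
as many eigenvalues near `ν` as the dimension of the eigenspace of `T` for the isolated
eigenvalue `ν`. -/
lemma IsEigenbasis.card_filter_eq (h : IsEigenbasis S b e) (hT : IsSelfAdjoint T)
    (hJ : ∀ v, ‖J v‖ = ‖v‖) (hη : ∀ v, ‖T (J v) - J (S v)‖ ≤ η * ‖v‖) (hη0 : 0 ≤ η)
    [FiniteDimensional 𝕜 E] (hE : ∀ f ∈ E, T f = (ν : 𝕜) • f)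
    (hgap : ∀ f ∈ Eᗮ, g * ‖f‖ ≤ ‖T f - (ν : 𝕜) • f‖)
    (happ : ∀ f ∈ E, ‖f‖ ≤ 2 * ‖ContinuousLinearMap.adjoint J f‖)
    (hr0 : 0 ≤ r) (hrg : r + η < g) (hηr : 2 * η < r) :
    (Finset.univ.filter fun i => |e i - ν| < r).card = Module.finrank 𝕜 E := by
  classical
  set s := Finset.univ.filter fun i => |e i - ν| < r with hs
  apply le_antisymm
  -- Upper bound: the nearby eigenvectors inject into `E` after applying `J` and projecting. On a
  -- kernel vector the gap gives `g ≤ r + η`, unless the vector vanishes.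
  · let φ : (s → 𝕜) →ₗ[𝕜] V := Fintype.linearCombination 𝕜 (fun i : s => b i)
    let ψ : (s → 𝕜) →ₗ[𝕜] E := E.orthogonalProjectionOnto.toLinearMap ∘ₗ J.toLinearMap ∘ₗ φ
    have hlin : LinearIndependent 𝕜 (fun i : s => b i) :=
      (b.orthonormal.linearIndependent).comp _ Subtype.val_injective
    have hψ : Function.Injective ψ := by
      rw [← LinearMap.ker_eq_bot, LinearMap.ker_eq_bot']
      intro c hc
      have hv : ∀ i, inner 𝕜 (b i) (φ c) ≠ 0 → |e i - ν| ≤ r := by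
        intro i hi
        by_contra! hlt
        refine hi ?_
        rw [Fintype.linearCombination_apply, inner_sum]
        refine Finset.sum_eq_zero fun j _ => ?_
        rw [inner_smul_right, b.inner_eq_ite, if_neg, mul_zero]
        rintro rfl
        have := (Finset.mem_filter.1 j.2).2
        linarith
      have h1 := h.norm_apply_sub_le hr0 hv
      have h2 : J (φ c) ∈ Eᗮ := by
        rwa [← Submodule.orthogonalProjectionOnto_eq_zero_iff]
      have h3 := hgap _ h2
      have h4 : ‖T (J (φ c)) - (ν : 𝕜) • J (φ c)‖ ≤ η * ‖φ c‖ + r * ‖φ c‖ := by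
        calc ‖T (J (φ c)) - (ν : 𝕜) • J (φ c)‖
            = ‖(T (J (φ c)) - J (S (φ c))) + J (S (φ c) - (ν : 𝕜) • φ c)‖ := by
              rw [map_sub, map_smul]; congr 1; abel
          _ ≤ _ := (norm_add_le _ _).trans (by rw [hJ]; exact add_le_add (hη _) h1)
      rw [hJ] at h3
      have h5 : ‖φ c‖ = 0 := by nlinarith [norm_nonneg (φ c)]
      have h6 : φ c = 0 := norm_eq_zero.1 h5
      exact (linearIndependent_iff_injective_fintypeLinearCombination.1 hlin)
        (h6.trans (map_zero φ).symm)
    have := LinearMap.finrank_le_finrank_of_injective hψ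
    simpa using this
  -- Lower bound: `E` injects into the nearby coordinates of the pullback `v`. On a kernel vector `r
  -- ‖v‖ ≤ η ‖f‖ ≤ 2 η ‖v‖`, so `2 η < r` forces `v = 0`.
  · let ψ : E →ₗ[𝕜] (s → 𝕜) := LinearMap.pi fun i =>
      (innerSL 𝕜 (b i)).toLinearMap ∘ₗ (ContinuousLinearMap.adjoint J).toLinearMap ∘ₗ E.subtype
    have hψ : Function.Injective ψ := by
      rw [← LinearMap.ker_eq_bot, LinearMap.ker_eq_bot']
      intro f hf
      set v := ContinuousLinearMap.adjoint J (f : H) with hv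
      have hvz : ∀ i, |e i - ν| < r → inner 𝕜 (b i) v = 0 := by
        intro i hi
        exact congrFun hf ⟨i, by simpa [hs] using hi⟩
      have h1 : r * ‖v‖ ≤ ‖S v - (ν : 𝕜) • v‖ :=
        h.mul_norm_le_norm_apply_sub hr0 fun i hi => ⟨rfl, not_lt.1 fun hlt => hi (hvz i hlt)⟩
      have h2 := h.norm_apply_adjoint_sub_le hT hη hη0 (f : H)
      rw [hE f f.2, map_smul, ← hv] at h2
      have h3 := happ f f.2
      have h4 : ‖(f : H)‖ = 0 := by nlinarith [norm_nonneg (f : H), norm_nonneg v]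
      exact Subtype.ext (norm_eq_zero.1 h4)
    have := LinearMap.finrank_le_finrank_of_injective hψ
    simpa using this

end Counting

/-! ### Hoeffding bounds for the centred adjacency matrix. -/

section RandomMatrix

open Matrix Filter Topology

lemma sum_prod_eq_sum_lt {N : ℕ} (f : Fin N → Fin N → ℝ) :
    ∑ i, ∑ j, f i j =
      (∑ p : {p : Fin N × Fin N // p.2 < p.1}, (f p.1.1 p.1.2 + f p.1.2 p.1.1)) + ∑ i, f i i := by
  have h1 : ∀ i j, f i j = (if j < i then f i j else 0) + (if i < j then f i j else 0) +
      (if i = j then f i j else 0) := by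
    intro i j
    rcases lt_trichotomy i j with h | h | h
    · simp [h, h.not_gt, h.ne]
    · simp [h]
    · simp [h, h.not_gt, h.ne']
  have h2 : ∀ g : Fin N → Fin N → ℝ,
      ∑ p : {p : Fin N × Fin N // p.2 < p.1}, g p.1.1 p.1.2 =
        ∑ i, ∑ j, if j < i then g i j else 0 := by
    intro g
    rw [← Fintype.sum_prod_type' (f := fun i j => if j < i then g i j else 0),
      ← Finset.sum_filter]
    exact (Finset.sum_subtype (Finset.univ.filter fun p : Fin N × Fin N => p.2 < p.1)
      (by simp) (fun p => g p.1 p.2)).symm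
  rw [Finset.sum_add_distrib, h2 f, h2 (fun i j => f j i)]
  conv_lhs => enter [2, i, 2, j]; rw [h1]
  simp only [Finset.sum_add_distrib]
  congr 1
  · congr 1
    rw [Finset.sum_comm]
  · simp

lemma dotProduct_mulVec_eq_sum {N : ℕ} (B : Matrix (Fin N) (Fin N) ℝ) (x y : Fin N → ℝ) :
    x ⬝ᵥ B *ᵥ y = ∑ i, ∑ j, x i * y j * B i j := by
  simp only [dotProduct, mulVec, Finset.mul_sum]
  refine Finset.sum_congr rfl fun i _ => Finset.sum_congr rfl fun j _ => ?_
  ring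

namespace Graphon.IsRandomAdjacency

variable {W : Graphon} {N : ℕ} {Ω : Type*} [MeasurableSpace Ω] {P : Measure Ω}
  {A : Ω → Matrix (Fin N) (Fin N) ℝ}

lemma integral_eq (h : W.IsRandomAdjacency P A) {i j : Fin N} (hij : j < i) :
    ∫ ω, A ω i j ∂P = W (gridPoint i) (gridPoint j) := by
  have h1 : (fun ω => A ω i j) = {ω | A ω i j = 1}.indicator 1 := by
    ext ω
    rcases h.binary ω i j with h | h <;> simp [indicator, h]
  have hm : MeasurableSet {ω | A ω i j = 1} := h.measurable i j (measurableSet_singleton 1)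
  rw [h1, integral_indicator_one hm, Measure.real, h.prob_eq i j hij,
    ENNReal.toReal_ofReal (W.mem_Icc _ _).1]

lemma hasSubgaussianMGF [IsProbabilityMeasure P] (h : W.IsRandomAdjacency P A) {i j : Fin N}
    (hij : j < i) :
    HasSubgaussianMGF (fun ω => (A ω - W.detAdjacency N) i j) ((1 / 2) ^ 2) P := by
  have h1 := hasSubgaussianMGF_of_mem_Icc (μ := P) (X := fun ω => A ω i j) (a := 0) (b := 1)
    (h.measurable i j).aemeasurable (ae_of_all _ fun ω => by
      rcases h.binary ω i j with h | h <;> simp [h])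
  rw [h.integral_eq hij] at h1
  convert h1 using 2
  · simp [Graphon.detAdjacency, hij.ne']
  · simp

lemma symm_sub (h : W.IsRandomAdjacency P A) (ω : Ω) (i j : Fin N) :
    (A ω - W.detAdjacency N) i j = (A ω - W.detAdjacency N) j i := by
  simp [Graphon.detAdjacency, h.symm ω i j, W.symm (gridPoint i), eq_comm]

lemma diag_sub (h : W.IsRandomAdjacency P A) (ω : Ω) (i : Fin N) :
    (A ω - W.detAdjacency N) i i = 0 := by
  simp [Graphon.detAdjacency, h.diag ω i]

lemma abs_sub_le (h : W.IsRandomAdjacency P A) (ω : Ω) (i j : Fin N) :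
    |(A ω - W.detAdjacency N) i j| ≤ 1 := by
  have h2 : W.detAdjacency N i j ∈ Icc (0 : ℝ) 1 := by
    by_cases hij : i = j
    · simp [Graphon.detAdjacency, hij]
    · simpa [Graphon.detAdjacency, hij] using W.mem_Icc (gridPoint i) (gridPoint j)
  rw [Matrix.sub_apply, abs_le]
  rcases h.binary ω i j with h | h <;> rw [h] <;> constructor <;> linarith [h2.1, h2.2]

/-- Symmetry and the zero diagonal fold the bilinear form onto the entries below the diagonal, which
are the independent ones. -/
lemma dotProduct_eq_sum (h : W.IsRandomAdjacency P A) (ω : Ω) (x y : Fin N → ℝ) :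
    x ⬝ᵥ (A ω - W.detAdjacency N) *ᵥ y =
      ∑ p : {p : Fin N × Fin N // p.2 < p.1},
        (x p.1.1 * y p.1.2 + x p.1.2 * y p.1.1) * (A ω - W.detAdjacency N) p.1.1 p.1.2 := by
  rw [dotProduct_mulVec_eq_sum, sum_prod_eq_sum_lt,
    Finset.sum_eq_zero (f := fun i => x i * y i * (A ω - W.detAdjacency N) i i)
      fun i _ => by rw [h.diag_sub, mul_zero], add_zero]
  refine Finset.sum_congr rfl fun p _ => ?_
  rw [h.symm_sub ω p.1.2 p.1.1]
  ring

/-- Hoeffding's inequality for the bilinear form of the centred adjacency matrix. -/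
lemma measureReal_le_abs_dotProduct_le [IsProbabilityMeasure P] (h : W.IsRandomAdjacency P A)
    (x y : Fin N → ℝ) {K t : ℝ} (hK : 0 < K) (hxy : (x ⬝ᵥ x) * (y ⬝ᵥ y) ≤ K) (ht : 0 ≤ t) :
    P.real {ω | t ≤ |x ⬝ᵥ (A ω - W.detAdjacency N) *ᵥ y|} ≤ 2 * Real.exp (-(t ^ 2 / K)) := by
  set a : {p : Fin N × Fin N // p.2 < p.1} → ℝ :=
    fun p => x p.1.1 * y p.1.2 + x p.1.2 * y p.1.1 with ha
  have hsum : ∑ p, a p ^ 2 ≤ 2 * K := by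
    have h1 := sum_prod_eq_sum_lt fun i j => x i ^ 2 * y j ^ 2
    have h2 : ∑ i, ∑ j, x i ^ 2 * y j ^ 2 = (x ⬝ᵥ x) * (y ⬝ᵥ y) := by
      simp only [dotProduct, Finset.sum_mul_sum, sq]
    have h3 : 0 ≤ ∑ i, x i ^ 2 * y i ^ 2 := Finset.sum_nonneg fun i _ => by positivity
    have h4 : ∑ p, a p ^ 2 ≤ 2 * ∑ p : {p : Fin N × Fin N // p.2 < p.1},
        (x p.1.1 ^ 2 * y p.1.2 ^ 2 + x p.1.2 ^ 2 * y p.1.1 ^ 2) := by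
      rw [Finset.mul_sum]
      refine Finset.sum_le_sum fun p _ => ?_
      have := sq_nonneg (x p.1.1 * y p.1.2 - x p.1.2 * y p.1.1)
      simp only [ha]
      nlinarith
    linarith
  have hind : iIndepFun (fun p ω => a p * (A ω - W.detAdjacency N) p.1.1 p.1.2) P := by
    have := h.indep.comp (fun p z => a p * (z - W.detAdjacency N p.1.1 p.1.2))
      (fun p => by fun_prop)
    exact this
  have hterm : ∀ p, HasSubgaussianMGF (fun ω => a p * (A ω - W.detAdjacency N) p.1.1 p.1.2)
      (‖a p‖₊ ^ 2 * (1 / 2) ^ 2) P := by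
    intro p
    convert (h.hasSubgaussianMGF p.2).const_mul (a p) using 2
    exact congrArg (fun z : NNReal => z * (1 / 2) ^ 2)
      (NNReal.eq (sq_abs (a p)) : ‖a p‖₊ ^ 2 = ⟨a p ^ 2, sq_nonneg (a p)⟩)
  have hsub := HasSubgaussianMGF.sum_of_iIndepFun hind (s := Finset.univ) fun p _ => hterm p
  have heq : ∀ ω, ∑ p, a p * (A ω - W.detAdjacency N) p.1.1 p.1.2 =
      x ⬝ᵥ (A ω - W.detAdjacency N) *ᵥ y := fun ω => (h.dotProduct_eq_sum ω x y).symm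
  simp only [heq] at hsub
  -- Each entry has variance proxy `1/4` and `∑ a² ≤ 2K`, so the total proxy is at most `K/2`; this
  -- makes the tail exponent exactly `t² / K`.
  have hsub' : HasSubgaussianMGF (fun ω => x ⬝ᵥ (A ω - W.detAdjacency N) *ᵥ y)
      (K / 2).toNNReal P := by
    refine ⟨hsub.integrable_exp_mul, fun s => (hsub.mgf_le s).trans ?_⟩
    rw [Real.exp_le_exp]
    gcongr
    have hval : ((∑ p, ‖a p‖₊ ^ 2 * (1 / 2) ^ 2 : NNReal) : ℝ) =
        (∑ p, a p ^ 2) / 4 := by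
      rw [NNReal.coe_sum, Finset.sum_div]
      refine Finset.sum_congr rfl fun p _ => ?_
      push_cast
      rw [Real.norm_eq_abs, sq_abs]
      ring
    refine NNReal.coe_le_coe.1 (hval.trans_le ?_)
    rw [Real.coe_toNNReal _ (by positivity)]
    linarith
  have hpos := hsub'.measure_ge_le ht
  have hneg := hsub'.neg.measure_ge_le ht
  rw [Real.coe_toNNReal _ (by positivity)] at hpos hneg
  have hexp : -t ^ 2 / (2 * (K / 2)) = -(t ^ 2 / K) := by
    field_simp
  rw [hexp] at hpos hneg
  calc _ ≤ P.real ({ω | t ≤ x ⬝ᵥ (A ω - W.detAdjacency N) *ᵥ y} ∪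
        {ω | t ≤ (-fun ω => x ⬝ᵥ (A ω - W.detAdjacency N) *ᵥ y) ω}) := by
        refine measureReal_mono fun ω hω => ?_
        rcases le_abs.1 (show t ≤ |_| from hω) with h | h
        · exact Or.inl h
        · exact Or.inr h
    _ ≤ _ := (measureReal_union_le _ _).trans (by linarith)

end Graphon.IsRandomAdjacency

/-! ### Discretization of the unit ball and operator norm concentration. -/

/-- Vectors with coordinates in `N⁻² ℤ ∩ [-1, 1]`. -/
noncomputable def integerGrid (N : ℕ) : Finset (Fin N → ℤ) :=
  Fintype.piFinset fun _ => Finset.Icc (-(N ^ 2 : ℤ)) (N ^ 2)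

lemma card_integerGrid (N : ℕ) : (integerGrid N).card = (2 * N ^ 2 + 1) ^ N := by
  rw [integerGrid, Fintype.card_piFinset]
  simp only [Int.card_Icc, Finset.prod_const, Finset.card_univ, Fintype.card_fin]
  congr 1
  have : ((N ^ 2 : ℕ) : ℤ) = (N : ℤ) ^ 2 := by push_cast; rfl
  omega

/-- The vector of `integerGrid N` with given integral coordinates. -/
noncomputable def gridVector {N : ℕ} (k : Fin N → ℤ) : Fin N → ℝ := fun i => k i / (N : ℝ) ^ 2

lemma abs_le_one_of_dotProduct_le_one {N : ℕ} {v : Fin N → ℝ} (hv : v ⬝ᵥ v ≤ 1) (i : Fin N) :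
    |v i| ≤ 1 := by
  rw [← sq_le_one_iff_abs_le_one]
  refine le_trans ?_ hv
  rw [sq]
  exact Finset.single_le_sum (f := fun i => v i * v i) (fun j _ => mul_self_nonneg _)
    (Finset.mem_univ i)

/-- Coordinates are rounded down. Rounding may leave the unit ball, but each squared coordinate is
at most `2 v_i² + 2/N`, which sums to at most `4`. -/
lemma exists_gridVector_close {N : ℕ} (hN : 0 < N) {v : Fin N → ℝ} (hv : v ⬝ᵥ v ≤ 1) :
    ∃ k ∈ integerGrid N, (∀ i, |v i - gridVector k i| ≤ 1 / (N : ℝ) ^ 2) ∧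
      gridVector k ⬝ᵥ gridVector k ≤ 4 := by
  have hN' : (1 : ℝ) ≤ N := by exact_mod_cast hN
  have hN2 : (0 : ℝ) < (N : ℝ) ^ 2 := by positivity
  have hvi := abs_le_one_of_dotProduct_le_one hv
  have hclose : ∀ i, |v i - gridVector (fun i => ⌊v i * (N : ℝ) ^ 2⌋) i| ≤ 1 / (N : ℝ) ^ 2 := by
    intro i
    have h1 := Int.floor_le (v i * (N : ℝ) ^ 2)
    have h2 := Int.lt_floor_add_one (v i * (N : ℝ) ^ 2)
    have h3 : v i - gridVector (fun i => ⌊v i * (N : ℝ) ^ 2⌋) i =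
        (v i * (N : ℝ) ^ 2 - ⌊v i * (N : ℝ) ^ 2⌋) / (N : ℝ) ^ 2 := by
      rw [gridVector]
      field_simp
    rw [h3, abs_div, abs_of_pos hN2, abs_of_nonneg (by linarith)]
    gcongr
    linarith
  refine ⟨fun i => ⌊v i * (N : ℝ) ^ 2⌋, ?_, hclose, ?_⟩
  · rw [integerGrid, Fintype.mem_piFinset]
    intro i
    rw [Finset.mem_Icc]
    have := abs_le.1 (hvi i)
    constructor
    · rw [Int.le_floor]
      push_cast
      nlinarith
    · rw [Int.floor_le_iff]
      push_cast
      nlinarith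
  · have h1 : ∀ i, gridVector (fun i => ⌊v i * (N : ℝ) ^ 2⌋) i *
        gridVector (fun i => ⌊v i * (N : ℝ) ^ 2⌋) i ≤ 2 * (v i * v i) + 2 / N := by
      intro i
      have h2 := hclose i
      set z := gridVector (fun i => ⌊v i * (N : ℝ) ^ 2⌋) i
      have h3 : 1 / (N : ℝ) ^ 2 ≤ 1 := by
        rw [div_le_one hN2]
        nlinarith
      have h4 : 1 / (N : ℝ) ^ 2 ≤ 1 / N := by
        gcongr
        nlinarith
      have h5 : (v i - z) ^ 2 ≤ 1 / N := by
        rw [← sq_abs]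
        nlinarith [abs_nonneg (v i - z)]
      have h6 : 2 / (N : ℝ) = 2 * (1 / N) := by ring
      nlinarith [sq_nonneg (2 * v i - z)]
    refine (Finset.sum_le_sum fun i _ => h1 i).trans ?_
    rw [Finset.sum_add_distrib, ← Finset.mul_sum]
    simp only [Finset.sum_const, Finset.card_univ, Fintype.card_fin, nsmul_eq_mul]
    have : (N : ℝ) * (2 / N) = 2 := by field_simp
    rw [this]
    have : ∑ i, v i * v i ≤ 1 := hv
    linarith

lemma abs_dotProduct_mulVec_le {N : ℕ} {B : Matrix (Fin N) (Fin N) ℝ} (hB : ∀ i j, |B i j| ≤ 1)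
    {x y : Fin N → ℝ} {α β : ℝ} (hα : 0 ≤ α) (hβ : 0 ≤ β) (hx : ∀ i, |x i| ≤ α)
    (hy : ∀ i, |y i| ≤ β) : |x ⬝ᵥ B *ᵥ y| ≤ (N : ℝ) ^ 2 * (α * β) := by
  rw [dotProduct_mulVec_eq_sum]
  calc _ ≤ ∑ i, ∑ j, |x i * y j * B i j| :=
        (Finset.abs_sum_le_sum_abs _ _).trans
          (Finset.sum_le_sum fun i _ => Finset.abs_sum_le_sum_abs _ _)
    _ ≤ ∑ i : Fin N, ∑ j : Fin N, α * β := by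
        refine Finset.sum_le_sum fun i _ => Finset.sum_le_sum fun j _ => ?_
        rw [abs_mul, abs_mul, ← mul_one (α * β)]
        have := hx i
        have := hy j
        have := hB i j
        gcongr
    _ = _ := by simp; ring

/-- The bilinear form of a matrix with entries bounded by one is controlled by its values on the
grid. -/
lemma abs_dotProduct_mulVec_le_of_grid {N : ℕ} {B : Matrix (Fin N) (Fin N) ℝ}
    (hB : ∀ i j, |B i j| ≤ 1) {t : ℝ}
    (hgrid : ∀ k ∈ integerGrid N, ∀ k' ∈ integerGrid N, gridVector k ⬝ᵥ gridVector k ≤ 4 →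
      gridVector k' ⬝ᵥ gridVector k' ≤ 4 → |gridVector k ⬝ᵥ B *ᵥ gridVector k'| ≤ t)
    (hN : 0 < N) {v w : Fin N → ℝ} (hv : v ⬝ᵥ v ≤ 1) (hw : w ⬝ᵥ w ≤ 1) :
    |v ⬝ᵥ B *ᵥ w| ≤ t + 3 := by
  obtain ⟨k, hk, hkv, hk4⟩ := exists_gridVector_close hN hv
  obtain ⟨k', hk', hkw, hk4'⟩ := exists_gridVector_close hN hw
  have hN' : (1 : ℝ) ≤ N := by exact_mod_cast hN
  have hN2 : (0 : ℝ) < (N : ℝ) ^ 2 := by positivity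
  have hinv : 1 / (N : ℝ) ^ 2 ≤ 1 := by
    rw [div_le_one hN2]
    nlinarith
  have hx2 : ∀ i, |gridVector k i| ≤ 2 := by
    intro i
    have h1 := abs_le.1 (hkv i)
    have h2 := abs_le.1 (abs_le_one_of_dotProduct_le_one hv i)
    rw [abs_le]
    constructor <;> linarith [h1.1, h1.2, h2.1, h2.2]
  have h1 := abs_dotProduct_mulVec_le hB (x := v - gridVector k) (y := w)
    (by positivity) zero_le_one hkv (abs_le_one_of_dotProduct_le_one hw)
  have h2 := abs_dotProduct_mulVec_le hB (x := gridVector k) (y := w - gridVector k')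
    zero_le_two (by positivity) hx2 hkw
  have h3 := hgrid k hk k' hk' hk4 hk4'
  have h4 : v ⬝ᵥ B *ᵥ w = (v - gridVector k) ⬝ᵥ B *ᵥ w +
      gridVector k ⬝ᵥ B *ᵥ (w - gridVector k') + gridVector k ⬝ᵥ B *ᵥ gridVector k' := by
    rw [mulVec_sub, sub_dotProduct, dotProduct_sub]
    ring
  -- Mesh `N⁻²` absorbs the `N²` entries of the matrix: replacing `v` costs `1`, and replacing `w`
  -- costs `2` because grid coordinates are bounded by `2`.
  have h5 : (N : ℝ) ^ 2 * (1 / (N : ℝ) ^ 2 * 1) = 1 := by field_simp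
  have h6 : (N : ℝ) ^ 2 * (2 * (1 / (N : ℝ) ^ 2)) = 2 := by field_simp
  rw [h5] at h1
  rw [h6] at h2
  rw [h4]
  exact (abs_add_three _ _ _).trans (by linarith)

/-- A matrix whose bilinear form is bounded by `τ` on the unit ball has operator norm at most
`τ`. -/
lemma dotProduct_self_mulVec_le {N : ℕ} {M : Matrix (Fin N) (Fin N) ℝ} {τ : ℝ}
    (h : ∀ x y : Fin N → ℝ, x ⬝ᵥ x ≤ 1 → y ⬝ᵥ y ≤ 1 → |x ⬝ᵥ M *ᵥ y| ≤ τ) (v : Fin N → ℝ) :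
    (M *ᵥ v) ⬝ᵥ (M *ᵥ v) ≤ τ ^ 2 * (v ⬝ᵥ v) := by
  have hnorm : ∀ {u : Fin N → ℝ}, u ≠ 0 → 0 < √(u ⬝ᵥ u) := by
    intro u hu
    refine Real.sqrt_pos.2 (lt_of_le_of_ne (dotProduct_self_nonneg_real u) fun h => hu ?_)
    exact dotProduct_self_eq_zero.1 h.symm
  have hunit : ∀ {u : Fin N → ℝ}, u ≠ 0 →
      ((√(u ⬝ᵥ u))⁻¹ • u) ⬝ᵥ ((√(u ⬝ᵥ u))⁻¹ • u) ≤ 1 := by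
    intro u hu
    have h1 := hnorm hu
    have h2 := Real.sq_sqrt (dotProduct_self_nonneg_real u)
    rw [smul_dotProduct, dotProduct_smul, smul_eq_mul, smul_eq_mul]
    nth_rewrite 3 [← h2]
    field_simp
    rfl
  by_cases hMv : M *ᵥ v = 0
  · rw [hMv, dotProduct_zero]
    have := dotProduct_self_nonneg_real v
    positivity
  have hv : v ≠ 0 := fun h => hMv (by rw [h, mulVec_zero])
  have h1 := h _ _ (hunit hMv) (hunit hv)
  have ha := hnorm hv
  have hb := hnorm hMv
  have ha2 := Real.sq_sqrt (dotProduct_self_nonneg_real v)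
  have hb2 := Real.sq_sqrt (dotProduct_self_nonneg_real (M *ᵥ v))
  set a := √(v ⬝ᵥ v)
  set b := √((M *ᵥ v) ⬝ᵥ (M *ᵥ v))
  rw [mulVec_smul, smul_dotProduct, dotProduct_smul, smul_eq_mul, smul_eq_mul, ← hb2] at h1
  have h2 : b⁻¹ * (a⁻¹ * b ^ 2) = b / a := by field_simp
  rw [h2, abs_of_pos (by positivity), div_le_iff₀ ha] at h1
  rw [← ha2, ← hb2, ← mul_pow]
  gcongr

lemma graphLaplacian_sub {N : ℕ} (A A' : Matrix (Fin N) (Fin N) ℝ) :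
    graphLaplacian A - graphLaplacian A' = graphLaplacian (A - A') := by
  ext i j
  simp only [graphLaplacian, Matrix.sub_apply, Matrix.diagonal_apply, Finset.sum_sub_distrib]
  split_ifs <;> ring

lemma abs_dotProduct_graphLaplacian_le {N : ℕ} {B : Matrix (Fin N) (Fin N) ℝ} {s t : ℝ}
    (ht : 0 ≤ t) (hdeg : ∀ i, |∑ j, B i j| ≤ t) {x y : Fin N → ℝ} (hx : x ⬝ᵥ x ≤ 1)
    (hy : y ⬝ᵥ y ≤ 1) (hB : |x ⬝ᵥ B *ᵥ y| ≤ s) : |x ⬝ᵥ graphLaplacian B *ᵥ y| ≤ s + t := by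
  rw [graphLaplacian, sub_mulVec, dotProduct_sub]
  refine (abs_sub _ _).trans (add_le_add hB ?_)
  calc |x ⬝ᵥ Matrix.diagonal (fun i => ∑ j, B i j) *ᵥ y|
      ≤ ∑ i, |x i * ((∑ j, B i j) * y i)| := by
        simp only [dotProduct, mulVec_diagonal]
        exact Finset.abs_sum_le_sum_abs _ _
    _ ≤ ∑ i, t / 2 * (x i * x i + y i * y i) := by
        refine Finset.sum_le_sum fun i _ => ?_
        rw [abs_mul, abs_mul]
        have h1 := hdeg i
        have h2 : |x i| * |y i| ≤ (x i * x i + y i * y i) / 2 := by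
          rw [← abs_mul_abs_self (x i), ← abs_mul_abs_self (y i)]
          nlinarith [sq_nonneg (|x i| - |y i|)]
        nlinarith [abs_nonneg (x i), abs_nonneg (y i),
          mul_nonneg (abs_nonneg (x i)) (abs_nonneg (y i))]
    _ = t / 2 * (x ⬝ᵥ x + y ⬝ᵥ y) := by
        rw [← Finset.mul_sum, Finset.sum_add_distrib]; rfl
    _ ≤ t := by nlinarith

namespace Graphon.IsRandomAdjacency

variable {W : Graphon} {N : ℕ} {Ω : Type*} [MeasurableSpace Ω] {P : Measure Ω}
  {A : Ω → Matrix (Fin N) (Fin N) ℝ}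

/-- Concentration of the Laplacian matrix around its mean in operator norm. -/
lemma le_measureReal_opNorm_le [IsProbabilityMeasure P] (h : W.IsRandomAdjacency P A)
    (hN : 0 < N) {s t : ℝ} (hs : 0 ≤ s) (ht : 0 ≤ t) :
    1 - (N * (2 * Real.exp (-(s ^ 2 / N))) +
        (((2 * N ^ 2 + 1) ^ N) ^ 2 : ℕ) * (2 * Real.exp (-(t ^ 2 / 16)))) ≤
      P.real {ω | ∀ v, ((graphLaplacian (A ω) - graphLaplacian (W.detAdjacency N)) *ᵥ v) ⬝ᵥ
        ((graphLaplacian (A ω) - graphLaplacian (W.detAdjacency N)) *ᵥ v) ≤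
          (t + 3 + s) ^ 2 * (v ⬝ᵥ v)} := by
  classical
  set B : Ω → Matrix (Fin N) (Fin N) ℝ := fun ω => A ω - W.detAdjacency N with hBdef
  set net := ((integerGrid N) ×ˢ (integerGrid N)).filter fun q =>
    gridVector q.1 ⬝ᵥ gridVector q.1 ≤ 4 ∧ gridVector q.2 ⬝ᵥ gridVector q.2 ≤ 4 with hnet
  set good := {ω | ∀ v, ((graphLaplacian (A ω) - graphLaplacian (W.detAdjacency N)) *ᵥ v) ⬝ᵥ
        ((graphLaplacian (A ω) - graphLaplacian (W.detAdjacency N)) *ᵥ v) ≤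
          (t + 3 + s) ^ 2 * (v ⬝ᵥ v)} with hgood
  -- A row sum is the bilinear form at a basis vector and the all-ones vector, whose squared norms
  -- multiply to `N`. For grid vectors the product is at most `4 * 4 = 16`.
  set bad₁ := ⋃ i ∈ (Finset.univ : Finset (Fin N)),
    {ω | s ≤ |(Pi.single i 1 : Fin N → ℝ) ⬝ᵥ B ω *ᵥ 1|} with hbad₁
  set bad₂ := ⋃ q ∈ net, {ω | t ≤ |gridVector q.1 ⬝ᵥ B ω *ᵥ gridVector q.2|} with hbad₂
  have hcover : (univ : Set Ω) ⊆ good ∪ (bad₁ ∪ bad₂) := by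
    intro ω _
    by_cases h1 : ω ∈ bad₁
    · exact Or.inr (Or.inl h1)
    by_cases h2 : ω ∈ bad₂
    · exact Or.inr (Or.inr h2)
    left
    simp only [hbad₁, hbad₂, mem_iUnion, mem_ofPred_eq, not_exists, not_le] at h1 h2
    have hdeg : ∀ i, |∑ j, B ω i j| ≤ s := by
      intro i
      have := h1 i (Finset.mem_univ i)
      simp only [single_dotProduct, one_mul, mulVec, dotProduct_one] at this
      exact this.le
    rw [hgood, mem_ofPred_eq, graphLaplacian_sub]
    refine dotProduct_self_mulVec_le fun x y hx hy => ?_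
    refine abs_dotProduct_graphLaplacian_le hs hdeg hx hy ?_
    refine abs_dotProduct_mulVec_le_of_grid (h.abs_sub_le ω) ?_ hN hx hy
    intro k hk k' hk' h4 h4'
    exact (h2 (k, k') (Finset.mem_filter.2 ⟨Finset.mem_product.2 ⟨hk, hk'⟩, h4, h4'⟩)).le
  have hN' : (0 : ℝ) < N := by exact_mod_cast hN
  have hb1 : P.real bad₁ ≤ N * (2 * Real.exp (-(s ^ 2 / N))) := by
    refine (measureReal_biUnion_finset_le _ _).trans ?_
    refine (Finset.sum_le_card_nsmul _ _ _ fun i _ =>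
      h.measureReal_le_abs_dotProduct_le _ _ hN' ?_ hs).trans_eq ?_
    · simp
    · simp
  have hb2 : P.real bad₂ ≤
      (((2 * N ^ 2 + 1) ^ N) ^ 2 : ℕ) * (2 * Real.exp (-(t ^ 2 / 16))) := by
    refine (measureReal_biUnion_finset_le _ _).trans ?_
    refine (Finset.sum_le_card_nsmul _ _ _ fun q hq =>
      h.measureReal_le_abs_dotProduct_le _ _ (by norm_num : (0 : ℝ) < 16) ?_ ht).trans ?_
    · have h4 := (Finset.mem_filter.1 hq).2
      have := dotProduct_self_nonneg_real (gridVector q.1)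
      have := dotProduct_self_nonneg_real (gridVector q.2)
      nlinarith [h4.1, h4.2]
    · rw [nsmul_eq_mul]
      gcongr
      refine (Finset.card_filter_le _ _).trans_eq ?_
      rw [Finset.card_product, card_integerGrid, ← sq]
  -- Subadditivity over a cover is enough, so no measurability of `good` has to be established.
  have hone : (1 : ℝ) ≤ P.real good + (P.real bad₁ + P.real bad₂) := by
    calc (1 : ℝ) = P.real univ := by simp
      _ ≤ P.real (good ∪ (bad₁ ∪ bad₂)) := measureReal_mono hcover
      _ ≤ _ := (measureReal_union_le _ _).trans (by gcongr; exact measureReal_union_le _ _)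
  linarith

end Graphon.IsRandomAdjacency

/-- The numerical estimate behind the union bound. -/
lemma eventually_union_bound_le {γ : ℝ} (hγ : 0 < γ) :
    ∀ᶠ N : ℕ in atTop, (N : ℝ) * (2 * Real.exp (-(((N : ℝ) ^ (1 / 2 + γ) / 2) ^ 2 / N))) +
        (((2 * N ^ 2 + 1) ^ N) ^ 2 : ℕ) *
          (2 * Real.exp (-(((N : ℝ) ^ (1 / 2 + γ) / 4) ^ 2 / 16))) ≤
      2 * (N : ℝ) * Real.exp (-(1 / 8 * (N : ℝ) ^ (2 * γ))) := by
  -- The grid pairs number at most `N^(6N) = exp(6 N log N)`. With `3072 = 6 * 512`, this entropy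
  -- uses up half of the exponent `N s / 256`, where `s = N^(2γ)`.
  have hlog : ∀ᶠ N : ℕ in atTop, Real.log N ≤ 1 / 3072 * (N : ℝ) ^ (2 * γ) := by
    have h1 := (isLittleO_log_rpow_atTop (r := 2 * γ) (by positivity)).comp_tendsto
      tendsto_natCast_atTop_atTop
    filter_upwards [h1.bound (c := 1 / 3072) (by norm_num)] with N hN
    simp only [Function.comp_apply, Real.norm_eq_abs] at hN
    rw [abs_of_nonneg (by positivity : (0 : ℝ) ≤ (N : ℝ) ^ (2 * γ))] at hN
    exact (le_abs_self _).trans hN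
  have hbig : ∀ᶠ N : ℕ in atTop, 8 ≤ (N : ℝ) ^ (2 * γ) :=
    ((tendsto_rpow_atTop (by positivity : 0 < 2 * γ)).comp
      tendsto_natCast_atTop_atTop).eventually_ge_atTop 8
  filter_upwards [hlog, hbig, eventually_ge_atTop 64] with N h1 h2 h3
  have hN : (64 : ℝ) ≤ N := by exact_mod_cast h3
  have hN0 : (0 : ℝ) < N := by linarith
  have hpow : ((N : ℝ) ^ (1 / 2 + γ)) ^ 2 = N * (N : ℝ) ^ (2 * γ) := by
    rw [← Real.rpow_natCast, ← Real.rpow_mul hN0.le]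
    rw [show (1 / 2 + γ) * ((2 : ℕ) : ℝ) = 1 + 2 * γ by push_cast; ring, Real.rpow_add hN0,
      Real.rpow_one]
  set s := (N : ℝ) ^ (2 * γ) with hs
  -- One factor `exp(-s/8)` is kept and the other is at most `1/2`. The degree and grid terms then
  -- each contribute `N exp(-s/8)`.
  have e1 : -(((N : ℝ) ^ (1 / 2 + γ) / 2) ^ 2 / N) = -(s / 8) + -(s / 8) := by
    rw [div_pow, hpow]
    field_simp
    ring
  have e2 : -(((N : ℝ) ^ (1 / 2 + γ) / 4) ^ 2 / 16) = -(N * s / 256) := by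
    rw [div_pow, hpow]
    ring
  have e3 : -(1 / 8 * s) = -(s / 8) := by ring
  rw [e1, e2, e3, Real.exp_add]
  have hhalf : Real.exp (-(s / 8)) ≤ 1 / 2 := by
    calc Real.exp (-(s / 8)) ≤ Real.exp (-1) := Real.exp_le_exp.2 (by linarith)
      _ ≤ 1 / 2 := by have := Real.exp_neg_one_lt_half; linarith
  have hpos := Real.exp_pos (-(s / 8))
  have hcard : ((((2 * N ^ 2 + 1) ^ N) ^ 2 : ℕ) : ℝ) ≤ Real.exp (N * s / 512) := by
    have h4 : ((2 * N ^ 2 + 1 : ℕ) : ℝ) ≤ (N : ℝ) ^ 3 := by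
      push_cast
      nlinarith [sq_nonneg (N : ℝ)]
    have h5 : (N : ℝ) ^ 3 = Real.exp (3 * Real.log N) := by
      rw [← Real.exp_log hN0, ← Real.exp_nat_mul, Real.log_exp]
      norm_num
    calc ((((2 * N ^ 2 + 1) ^ N) ^ 2 : ℕ) : ℝ) = ((2 * N ^ 2 + 1 : ℕ) : ℝ) ^ (N * 2) := by
          rw [pow_mul]; push_cast; rfl
      _ ≤ (Real.exp (3 * Real.log N)) ^ (N * 2) := by
          rw [← h5]; gcongr
      _ = Real.exp ((N * 2 : ℕ) * (3 * Real.log N)) := (Real.exp_nat_mul _ _).symm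
      _ ≤ Real.exp (N * s / 512) := by
          rw [Real.exp_le_exp]
          push_cast
          nlinarith
  have hsecond : ((((2 * N ^ 2 + 1) ^ N) ^ 2 : ℕ) : ℝ) * (2 * Real.exp (-(N * s / 256))) ≤
      N * Real.exp (-(s / 8)) := by
    calc _ ≤ Real.exp (N * s / 512) * (2 * Real.exp (-(N * s / 256))) := by gcongr
      _ = 2 * Real.exp (-(N * s / 512)) := by
          rw [mul_left_comm, ← Real.exp_add]
          ring_nf
      _ ≤ N * Real.exp (-(s / 8)) := by
          have : Real.exp (-(N * s / 512)) ≤ Real.exp (-(s / 8)) :=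
            Real.exp_le_exp.2 (by nlinarith)
          nlinarith
  nlinarith [mul_le_mul_of_nonneg_left hhalf (mul_pos hN0 hpos).le]

/-- With overwhelming probability the random Laplacian matrix is within `N ^ (1 / 2 + γ)` of the
deterministic one in operator norm. -/
lemma Graphon.eventually_le_measureReal_opNorm_le {γ : ℝ} (hγ : 0 < γ) :
    ∀ᶠ N : ℕ in atTop, ∀ (W : Graphon) (Ω : Type*) [MeasurableSpace Ω] (P : Measure Ω)
      [IsProbabilityMeasure P] (A : Ω → Matrix (Fin N) (Fin N) ℝ), W.IsRandomAdjacency P A →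
      1 - 2 * (N : ℝ) * Real.exp (-(1 / 8 * (N : ℝ) ^ (2 * γ))) ≤
        P.real {ω | ∀ v, ((graphLaplacian (A ω) - graphLaplacian (W.detAdjacency N)) *ᵥ v) ⬝ᵥ
          ((graphLaplacian (A ω) - graphLaplacian (W.detAdjacency N)) *ᵥ v) ≤
            ((N : ℝ) ^ (1 / 2 + γ)) ^ 2 * (v ⬝ᵥ v)} := by
  -- The threshold `12` lets the remaining quarter of `N^(1/2+γ)` absorb the additive `3` from the
  -- grid approximation.
  have hbig : ∀ᶠ N : ℕ in atTop, 12 ≤ (N : ℝ) ^ (1 / 2 + γ) :=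
    ((tendsto_rpow_atTop (by positivity : 0 < 1 / 2 + γ)).comp
      tendsto_natCast_atTop_atTop).eventually_ge_atTop 12
  filter_upwards [eventually_union_bound_le hγ, hbig, eventually_gt_atTop 0] with N h1 h2 h3
  intro W Ω _ P _ A hA
  have h4 := hA.le_measureReal_opNorm_le h3 (s := (N : ℝ) ^ (1 / 2 + γ) / 2)
    (t := (N : ℝ) ^ (1 / 2 + γ) / 4) (by positivity) (by positivity)
  refine le_trans (by linarith) (h4.trans (measureReal_mono fun ω hω v => (hω v).trans ?_))
  have := dotProduct_self_nonneg_real v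
  gcongr
  linarith

end RandomMatrix

/-! ### Self-adjointness of the graphon Laplacian. -/

namespace Graphon

open Matrix Filter Topology ComplexConjugate

lemma coeFn_laplacian (W : Graphon) (f : Lp ℂ 2 (volume : Measure I)) :
    W.laplacian f =ᵐ[volume] W.laplacianFun f :=
  MemLp.coeFn_toLp (W.memLp_laplacianFun (Lp.memLp f))

/-- The graphon Laplacian is self-adjoint. -/
lemma isSelfAdjoint_laplacian (W : Graphon) : IsSelfAdjoint W.laplacian := by
  rw [ContinuousLinearMap.isSelfAdjoint_iff_isSymmetric]
  intro f g
  have hf : MemLp f 2 volume := Lp.memLp f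
  have hg : MemLp g 2 volume := Lp.memLp g
  have hfi : Integrable f := hf.integrable (by norm_num)
  have hgi : Integrable g := hg.integrable (by norm_num)
  have hfc : Integrable (fun x => conj (f x)) := by
    refine (Complex.conjCLE.toContinuousLinearMap).integrable_comp hfi
  have hfg : Integrable (fun x => g x * conj (f x)) := by
    refine (hg.integrable_mul (q := 2) (f := g) (g := fun x => conj (f x)) ?_)
    exact hf.star
  have hbdd : ∀ᵐ p ∂(volume.prod volume : Measure (I × I)), ‖(W p.1 p.2 : ℂ)‖ ≤ 1 :=
    Eventually.of_forall fun p => W.norm_le_one p.1 p.2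
  have hF₁ : Integrable (fun p : I × I => (W p.1 p.2 : ℂ) * (g p.1 * conj (f p.2)))
      (volume.prod volume) := (hgi.mul_prod hfc).bdd_mul W.aesm_prod hbdd
  have hF₂ : Integrable (fun p : I × I => (W p.1 p.2 : ℂ) * (g p.1 * conj (f p.1)))
      (volume.prod volume) := (hfg.comp_fst volume).bdd_mul W.aesm_prod hbdd
  have hF₃ : Integrable (fun p : I × I => (W p.1 p.2 : ℂ) * (g p.2 * conj (f p.1)))
      (volume.prod volume) := by
    refine Integrable.bdd_mul ?_ W.aesm_prod hbdd
    exact (hfc.mul_prod hgi).congr (Eventually.of_forall fun p => mul_comm _ _)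
  -- The degree term is the same on both sides; only the kernel term needs the symmetry of `W`,
  -- through exchange of variables.
  have hswap : ∫ p : I × I, (W p.1 p.2 : ℂ) * (g p.1 * conj (f p.2)) ∂(volume.prod volume) =
      ∫ p : I × I, (W p.1 p.2 : ℂ) * (g p.2 * conj (f p.1)) ∂(volume.prod volume) := by
    rw [← integral_prod_swap]
    refine integral_congr_ae (Eventually.of_forall fun p => ?_)
    simp only [Prod.fst_swap, Prod.snd_swap, W.symm p.1 p.2]
  have hleft : inner ℂ (W.laplacian f) g =
      ∫ p : I × I, ((W p.1 p.2 : ℂ) * (g p.1 * conj (f p.2)) -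
        (W p.1 p.2 : ℂ) * (g p.1 * conj (f p.1))) ∂(volume.prod volume) := by
    rw [L2.inner_def]
    refine Eq.trans ?_ (integral_prod _ (hF₁.sub hF₂)).symm
    refine integral_congr_ae ?_
    filter_upwards [W.coeFn_laplacian f] with x hx
    rw [hx, RCLike.inner_apply, laplacianFun, ← integral_conj, ← integral_const_mul]
    refine integral_congr_ae (Eventually.of_forall fun y => ?_)
    simp only [map_mul, map_sub, Complex.conj_ofReal, Pi.sub_apply]
    ring
  have hright : inner ℂ f (W.laplacian g) =
      ∫ p : I × I, ((W p.1 p.2 : ℂ) * (g p.2 * conj (f p.1)) -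
        (W p.1 p.2 : ℂ) * (g p.1 * conj (f p.1))) ∂(volume.prod volume) := by
    rw [L2.inner_def]
    refine Eq.trans ?_ (integral_prod _ (hF₃.sub hF₂)).symm
    refine integral_congr_ae ?_
    filter_upwards [W.coeFn_laplacian g] with x hx
    rw [hx, RCLike.inner_apply, laplacianFun, ← integral_mul_const]
    refine integral_congr_ae (Eventually.of_forall fun y => ?_)
    simp only [Pi.sub_apply]
    ring
  change inner ℂ (W.laplacian f) g = inner ℂ f (W.laplacian g)
  rw [hleft, hright, integral_sub hF₁ hF₂, integral_sub hF₃ hF₂, hswap]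

end Graphon

/-! ### Step functions on the grid. -/

section StepEmbedding

open Matrix Filter Topology

variable {N : ℕ}

/-- The index of the grid cell `(i/N, (i+1)/N]` containing `x` (with `0` in the first cell). -/
noncomputable def cellIndex (hN : 0 < N) (x : I) : Fin N :=
  ⟨⌈(N : ℝ) * x⌉₊ - 1, by
    have : ⌈(N : ℝ) * x⌉₊ ≤ N := Nat.ceil_le.2 (mul_le_of_le_one_right (Nat.cast_nonneg N) x.2.2)
    omega⟩

lemma measurable_cellIndex (hN : 0 < N) : Measurable (cellIndex hN) := by
  have h1 : Measurable fun x : I => ⌈(N : ℝ) * x⌉₊ - 1 := by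
    have : Measurable fun x : I => ⌈(N : ℝ) * x⌉₊ := Nat.measurable_ceil.comp (by fun_prop)
    exact (measurable_of_countable fun n : ℕ => n - 1).comp this
  refine measurable_to_countable' fun i => ?_
  have h2 : cellIndex hN ⁻¹' {i} = (fun x : I => ⌈(N : ℝ) * x⌉₊ - 1) ⁻¹' {(i : ℕ)} := by
    ext x
    simp [cellIndex, Fin.ext_iff]
  rw [h2]
  exact h1 (measurableSet_singleton _)

lemma cellIndex_eq_iff (hN : 0 < N) {x : I} (hx : 0 < (x : ℝ)) (i : Fin N) :
    cellIndex hN x = i ↔ (i : ℝ) / N < x ∧ (x : ℝ) ≤ ((i : ℝ) + 1) / N := by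
  have hN' : (0 : ℝ) < N := by exact_mod_cast hN
  have hpos : 0 < ⌈(N : ℝ) * x⌉₊ := Nat.ceil_pos.2 (by positivity)
  rw [div_lt_iff₀' hN', le_div_iff₀' hN', Fin.ext_iff]
  have h1 : (i : ℝ) < N * x ↔ (i : ℕ) < ⌈(N : ℝ) * x⌉₊ := Nat.lt_ceil.symm
  have h2 : (N : ℝ) * x ≤ i + 1 ↔ ⌈(N : ℝ) * x⌉₊ ≤ i + 1 := by
    rw [Nat.ceil_le]
    push_cast
    rfl
  rw [h1, h2]
  simp only [cellIndex]
  omega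

lemma abs_sub_gridPoint_le (hN : 0 < N) (x : I) :
    |(x : ℝ) - gridPoint (cellIndex hN x)| ≤ 1 / N := by
  have hN' : (0 : ℝ) < N := by exact_mod_cast hN
  rcases x.2.1.eq_or_lt with hx | hx
  · have h1 : cellIndex hN x = ⟨0, hN⟩ := by
      simp [cellIndex, ← hx]
    rw [h1, ← hx]
    simp [gridPoint]
  · have h1 := (cellIndex_eq_iff hN hx (cellIndex hN x)).1 rfl
    have h2 : ((gridPoint (cellIndex hN x) : I) : ℝ) = ((cellIndex hN x : ℕ) : ℝ) / N + 1 / N := by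
      rw [gridPoint]
      ring
    rw [add_div] at h1
    rw [h2, abs_le]
    constructor <;> linarith [h1.1, h1.2]

lemma volume_cellIndex_preimage (hN : 0 < N) (i : Fin N) :
    (volume : Measure I).real (cellIndex hN ⁻¹' {i}) = 1 / N := by
  have hN' : (0 : ℝ) < N := by exact_mod_cast hN
  have hi : ((i : ℕ) : ℝ) ≤ N := by exact_mod_cast i.2.le
  let q : I := ⟨(i : ℝ) / N, by positivity, div_le_one_of_le₀ hi hN'.le⟩
  -- The two sets can differ only at `0`, which truncated subtraction places in the first cell.
  have hae : (cellIndex hN ⁻¹' {i} : Set I) =ᵐ[volume] Ioc q (gridPoint i) := by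
    have h0 : ∀ᵐ x : I, x ≠ 0 := by
      rw [ae_iff]
      simp
    filter_upwards [h0] with x hx
    have hx' : 0 < (x : ℝ) := lt_of_le_of_ne x.2.1 fun h => hx (Subtype.ext h.symm)
    exact propext (cellIndex_eq_iff hN hx' i)
  rw [Measure.real, measure_congr hae, unitInterval.volume_Ioc]
  have h1 : ((gridPoint i : I) : ℝ) - q = 1 / N := by
    simp only [gridPoint, q]
    ring
  rw [h1, ENNReal.toReal_ofReal (by positivity)]

lemma integral_comp_cellIndex (hN : 0 < N) {E : Type*} [NormedAddCommGroup E] [NormedSpace ℝ E]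
    [CompleteSpace E] (F : Fin N → E) : ∫ x : I, F (cellIndex hN x) = (1 / N : ℝ) • ∑ i, F i := by
  have hm := measurable_cellIndex hN
  have : IsFiniteMeasure (Measure.map (cellIndex hN) (volume : Measure I)) :=
    Measure.isFiniteMeasure_map _ _
  rw [← integral_map hm.aemeasurable (StronglyMeasurable.of_discrete.aestronglyMeasurable),
    integral_fintype (Integrable.of_finite), Finset.smul_sum]
  refine Finset.sum_congr rfl fun i _ => ?_
  rw [map_measureReal_apply hm (measurableSet_singleton i), volume_cellIndex_preimage]

lemma memLp_comp_cellIndex (hN : 0 < N) (F : Fin N → ℂ) :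
    MemLp (fun x : I => F (cellIndex hN x)) 2 volume := by
  have hm : Measurable fun x : I => F (cellIndex hN x) :=
    (measurable_of_countable F).comp (measurable_cellIndex hN)
  refine MemLp.of_bound hm.aestronglyMeasurable (∑ i, ‖F i‖) (Eventually.of_forall fun x => ?_)
  exact Finset.single_le_sum (f := fun i => ‖F i‖) (fun i _ => norm_nonneg _) (Finset.mem_univ _)

lemma sq_norm_Lp_eq_integral (f : Lp ℂ 2 (volume : Measure I)) :
    ‖f‖ ^ 2 = ∫ x, ‖f x‖ ^ 2 := by
  have h := L2.inner_def (𝕜 := ℂ) f f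
  rw [inner_self_eq_norm_sq_to_K] at h
  have h2 : ∀ x, inner ℂ (f x) (f x) = ((‖f x‖ ^ 2 : ℝ) : ℂ) := by
    intro x
    rw [inner_self_eq_norm_sq_to_K]
    push_cast
    rfl
  simp only [h2] at h
  rw [integral_complex_ofReal] at h
  apply Complex.ofReal_injective
  rw [Complex.ofReal_pow]
  exact h

/-- The normalized step function with given values on the grid cells. -/
noncomputable def stepFunction (hN : 0 < N) (v : EuclideanSpace ℂ (Fin N)) (x : I) : ℂ :=
  (√N : ℂ) * v (cellIndex hN x)

lemma memLp_stepFunction (hN : 0 < N) (v : EuclideanSpace ℂ (Fin N)) :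
    MemLp (stepFunction hN v) 2 volume :=
  memLp_comp_cellIndex hN fun i => (√N : ℂ) * v i

lemma norm_toLp_stepFunction (hN : 0 < N) (v : EuclideanSpace ℂ (Fin N)) :
    ‖(memLp_stepFunction hN v).toLp _‖ = ‖v‖ := by
  rw [← sq_eq_sq₀ (norm_nonneg _) (norm_nonneg _)]
  have hN' : (0 : ℝ) < N := by exact_mod_cast hN
  rw [sq_norm_Lp_eq_integral]
  have h1 : ∫ x, ‖(memLp_stepFunction hN v).toLp _ x‖ ^ 2 =
      ∫ x : I, (fun i => (N : ℝ) * ‖v i‖ ^ 2) (cellIndex hN x) := by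
    refine integral_congr_ae ?_
    filter_upwards [MemLp.coeFn_toLp (memLp_stepFunction hN v)] with x hx
    rw [hx, stepFunction, norm_mul, mul_pow, Complex.norm_real, Real.norm_eq_abs, sq_abs,
      Real.sq_sqrt hN'.le]
  rw [h1, integral_comp_cellIndex hN fun i => (N : ℝ) * ‖v i‖ ^ 2, ← Finset.mul_sum,
    EuclideanSpace.norm_sq_eq, smul_eq_mul]
  field_simp

/-- The isometric embedding of `ℂ^N` into `L²([0,1]; ℂ)` as step functions. -/
noncomputable def stepEmbedding (hN : 0 < N) :
    EuclideanSpace ℂ (Fin N) →L[ℂ] Lp ℂ 2 (volume : Measure I) :=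
  LinearMap.mkContinuous
    { toFun := fun v => (memLp_stepFunction hN v).toLp _
      map_add' := fun v w => by
        rw [← MemLp.toLp_add]
        refine MemLp.toLp_congr _ _ (Eventually.of_forall fun x => ?_)
        simp [stepFunction, mul_add]
      map_smul' := fun c v => by
        rw [RingHom.id_apply, ← MemLp.toLp_const_smul]
        refine MemLp.toLp_congr _ _ (Eventually.of_forall fun x => ?_)
        simp only [stepFunction, PiLp.smul_apply, Pi.smul_apply, smul_eq_mul]
        ring } 1 fun v => by
    rw [one_mul]
    exact (norm_toLp_stepFunction hN v).le

lemma norm_stepEmbedding (hN : 0 < N) (v : EuclideanSpace ℂ (Fin N)) :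
    ‖stepEmbedding hN v‖ = ‖v‖ :=
  norm_toLp_stepFunction hN v

lemma coeFn_stepEmbedding (hN : 0 < N) (v : EuclideanSpace ℂ (Fin N)) :
    stepEmbedding hN v =ᵐ[volume] stepFunction hN v :=
  MemLp.coeFn_toLp (memLp_stepFunction hN v)

/-- Step functions approximate every square integrable function. -/
lemma eventually_exists_norm_sub_stepEmbedding_le (f : Lp ℂ 2 (volume : Measure I)) {κ : ℝ}
    (hκ : 0 < κ) :
    ∀ᶠ N : ℕ in atTop, ∀ hN : 0 < N, ∃ v, ‖f - stepEmbedding hN v‖ ≤ κ := by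
  obtain ⟨g, hg⟩ := (ContinuousMap.toLp_denseRange ℂ (volume : Measure I) ℂ
    (p := 2) (by norm_num)).exists_dist_lt f (half_pos hκ)
  have huc := CompactSpace.uniformContinuous_of_continuous g.continuous
  obtain ⟨d, hd, hgd⟩ := Metric.uniformContinuous_iff.1 huc (κ / 2) (half_pos hκ)
  have hsmall : ∀ᶠ N : ℕ in atTop, 1 / (N : ℝ) < d :=
    tendsto_one_div_atTop_nhds_zero_nat.eventually_lt_const hd
  filter_upwards [hsmall] with N hNd hN
  have hN' : (0 : ℝ) < N := by exact_mod_cast hN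
  have hsq : (√N : ℂ) ≠ 0 := by exact_mod_cast (Real.sqrt_pos.2 hN').ne'
  set v : EuclideanSpace ℂ (Fin N) := WithLp.toLp 2 fun i => (√N : ℂ)⁻¹ * g (gridPoint i) with hv
  refine ⟨v, ?_⟩
  set g' := ContinuousMap.toLp 2 (volume : Measure I) ℂ g with hg'
  have h1 : ‖g' - stepEmbedding hN v‖ ≤ κ / 2 := by
    have := Lp.norm_le_of_ae_bound (f := g' - stepEmbedding hN v) (half_pos hκ).le ?_
    · simpa [measureUnivNNReal] using this
    · filter_upwards [Lp.coeFn_sub g' (stepEmbedding hN v), coeFn_stepEmbedding hN v,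
        ContinuousMap.coeFn_toLp (p := 2) (𝕜 := ℂ) (volume : Measure I) g] with x hx1 hx2 hx3
      rw [hx1, Pi.sub_apply, hx2, hx3, stepFunction, hv]
      simp only
      rw [mul_inv_cancel_left₀ hsq, ← dist_eq_norm]
      refine (hgd ?_).le
      rw [Subtype.dist_eq, Real.dist_eq]
      exact (abs_sub_gridPoint_le hN x).trans_lt hNd
  calc ‖f - stepEmbedding hN v‖ = ‖(f - g') + (g' - stepEmbedding hN v)‖ := by
        rw [sub_add_sub_cancel]
    _ ≤ κ / 2 + κ / 2 := (norm_add_le _ _).trans (add_le_add (by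
        rw [← dist_eq_norm]; exact hg.le) h1)
    _ = κ := add_halves κ

/-- On a finite-dimensional space of functions the adjoint of the step embedding is eventually
bounded below. -/
lemma eventually_norm_le_two_mul_norm_adjoint_stepEmbedding
    (E : Submodule ℂ (Lp ℂ 2 (volume : Measure I))) [FiniteDimensional ℂ E] :
    ∀ᶠ N : ℕ in atTop, ∀ hN : 0 < N, ∀ f ∈ E,
      ‖f‖ ≤ 2 * ‖ContinuousLinearMap.adjoint (stepEmbedding hN) f‖ := by
  set b := stdOrthonormalBasis ℂ E with hb
  set d := Module.finrank ℂ E with hd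
  -- Approximating each of the `d` basis vectors within `κ` costs at most `d κ ‖f‖ ≤ ‖f‖ / 4`; `d +
  -- 1` keeps `κ` meaningful when `d = 0`.
  set κ : ℝ := 1 / (4 * (d + 1)) with hκ
  have hκ0 : 0 < κ := by positivity
  have hall : ∀ᶠ N : ℕ in atTop, ∀ k, ∀ hN : 0 < N,
      ∃ v, ‖(b k : Lp ℂ 2 (volume : Measure I)) - stepEmbedding hN v‖ ≤ κ :=
    eventually_all.2 fun k => eventually_exists_norm_sub_stepEmbedding_le _ hκ0
  filter_upwards [hall] with N h hN f hf
  choose v hv using fun k => h k hN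
  set J := stepEmbedding hN with hJ
  set g : E := ⟨f, hf⟩ with hg
  set w := ∑ k, inner ℂ (b k) g • v k with hw
  have hfs : f = ∑ k, inner ℂ (b k) g • (b k : Lp ℂ 2 (volume : Measure I)) := by
    have := congrArg (Subtype.val) (b.sum_repr' g)
    simpa using this.symm
  have h1 : ‖f - J w‖ ≤ ‖f‖ / 4 := by
    have h2 : f - J w = ∑ k, inner ℂ (b k) g • ((b k : Lp ℂ 2 (volume : Measure I)) - J (v k)) := by
      simp only [smul_sub, Finset.sum_sub_distrib, ← hfs, hw, map_sum, map_smul]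
    rw [h2]
    calc _ ≤ ∑ k, ‖inner ℂ (b k) g • ((b k : Lp ℂ 2 (volume : Measure I)) - J (v k))‖ :=
          norm_sum_le _ _
      _ ≤ ∑ k : Fin d, ‖f‖ * κ := by
          refine Finset.sum_le_sum fun k _ => ?_
          rw [norm_smul]
          have h3 : ‖inner ℂ (b k) g‖ ≤ ‖f‖ := by
            have := norm_inner_le_norm (𝕜 := ℂ) (b k) g
            rwa [b.norm_eq_one, one_mul] at this
          exact mul_le_mul h3 (hv k) (norm_nonneg _) (norm_nonneg _)
      _ = d * κ * ‖f‖ := by simp; ring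
      _ ≤ ‖f‖ / 4 := by
          have : d * κ ≤ 1 / 4 := by
            rw [hκ, mul_one_div, div_le_div_iff₀ (by positivity) (by norm_num)]
            linarith
          nlinarith [norm_nonneg f]
  have hadj : ContinuousLinearMap.adjoint J (J w) = w := by
    refine ext_inner_left ℂ fun u => ?_
    rw [ContinuousLinearMap.adjoint_inner_right]
    exact (LinearIsometry.mk J.toLinearMap (norm_stepEmbedding hN)).inner_map_map u w
  have hJ1 : ‖J‖ ≤ 1 := ContinuousLinearMap.opNorm_le_bound _ zero_le_one fun u => by
    rw [hJ, norm_stepEmbedding, one_mul]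
  have h4 : ‖ContinuousLinearMap.adjoint J f - w‖ ≤ ‖f‖ / 4 := by
    rw [← hadj, ← map_sub]
    refine (ContinuousLinearMap.le_opNorm _ _).trans ?_
    rw [LinearIsometryEquiv.norm_map]
    nlinarith [norm_nonneg (f - J w)]
  have h5 : ‖J w‖ = ‖w‖ := norm_stepEmbedding hN w
  -- Two losses of `‖f‖ / 4`, one for `f` against `J w` and one for the adjoint image against `w`,
  -- leave half of `‖f‖`.
  have h6 := norm_le_norm_add_norm_sub' f (J w)
  have h7 := norm_le_norm_add_norm_sub' w (ContinuousLinearMap.adjoint J f)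
  rw [norm_sub_rev] at h7
  linarith

end StepEmbedding

/-! ### Comparison of the matrix and graphon Laplacians. -/

section DiscretizationError

open Matrix Filter Topology

lemma norm_Lp_le_of_ae_le {f u : Lp ℂ 2 (volume : Measure I)} {c d : ℝ} (hc : 0 ≤ c) (hd : 0 ≤ d)
    (h : ∀ᵐ x, ‖f x‖ ≤ c + d * ‖u x‖) : ‖f‖ ≤ c + d * ‖u‖ := by
  have hum := (Lp.memLp u).norm
  have hcm : MemLp (fun _ : I => c) 2 volume := memLp_const c
  have h2 : ‖f‖ ≤ ‖hcm.toLp _ + d • hum.toLp _‖ := by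
    refine Lp.norm_le_norm_of_ae_le ?_
    filter_upwards [h, Lp.coeFn_add (hcm.toLp _) (d • hum.toLp _), MemLp.coeFn_toLp hcm,
      Lp.coeFn_smul d (hum.toLp _), MemLp.coeFn_toLp hum] with x hx h1 h2 h3 h4
    rw [h1, Pi.add_apply, h2, h3, Pi.smul_apply, h4]
    exact hx.trans (le_abs_self _)
  have h3 : ‖hcm.toLp _‖ ≤ c := by
    rw [Lp.norm_toLp, eLpNorm_const _ (by norm_num) (NeZero.ne _)]
    simp [abs_of_nonneg hc]
  have h4 : ‖hum.toLp _‖ = ‖u‖ := by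
    rw [Lp.norm_toLp, eLpNorm_norm, Lp.norm_def]
  calc _ ≤ _ := h2
    _ ≤ ‖hcm.toLp _‖ + ‖d • hum.toLp _‖ := norm_add_le _ _
    _ ≤ _ := by
      rw [norm_smul, h4, Real.norm_of_nonneg hd]
      linarith

lemma laplacianFun_congr_ae (W : Graphon) {f g : I → ℂ} (h : f =ᵐ[volume] g) {x : I}
    (hx : f x = g x) : W.laplacianFun f x = W.laplacianFun g x := by
  refine integral_congr_ae ?_
  filter_upwards [h] with y hy
  rw [hx, hy]

lemma detAdjacency_mem_Icc (W : Graphon) {N : ℕ} (i j : Fin N) :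
    W.detAdjacency N i j ∈ Icc (0 : ℝ) 1 := by
  by_cases hij : i = j
  · simp [Graphon.detAdjacency, hij]
  · simpa [Graphon.detAdjacency, hij] using W.mem_Icc (gridPoint i) (gridPoint j)

lemma isHermitian_graphLaplacian {N : ℕ} {A : Matrix (Fin N) (Fin N) ℝ}
    (hA : ∀ i j, A i j = A j i) : (graphLaplacian A).IsHermitian := by
  refine IsHermitian.ext fun i j => ?_
  simp only [graphLaplacian, Matrix.sub_apply, Matrix.diagonal_apply, star_trivial]
  rw [hA i j]
  by_cases h : i = j
  · subst h; rfl
  · simp [h, Ne.symm h]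

lemma detAdjacency_symm (W : Graphon) {N : ℕ} (i j : Fin N) :
    W.detAdjacency N i j = W.detAdjacency N j i := by
  simp [Graphon.detAdjacency, W.symm (gridPoint i), eq_comm]

/-- The complexified matrix acts on a step function as the Laplacian of the step graphon. -/
lemma stepFunction_graphLaplacian {N : ℕ} (hN : 0 < N) (A : Matrix (Fin N) (Fin N) ℝ)
    (v : EuclideanSpace ℂ (Fin N)) (x : I) :
    stepFunction hN (toLpLin 2 2 ((graphLaplacian A).map (algebraMap ℝ ℂ)) v) x =
      N * ∫ y : I, (A (cellIndex hN x) (cellIndex hN y) : ℂ) *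
        (stepFunction hN v y - stepFunction hN v x) := by
  have hN' : (N : ℂ) ≠ 0 := by exact_mod_cast hN.ne'
  set i := cellIndex hN x with hi
  have h1 := integral_comp_cellIndex hN fun j =>
    (A i j : ℂ) * ((√N : ℂ) * v j - (√N : ℂ) * v i)
  simp only [stepFunction] at *
  rw [h1, ← hi, toLpLin_apply]
  simp only [mulVec, dotProduct, Matrix.map_apply, graphLaplacian, Matrix.sub_apply,
    Matrix.diagonal_apply, Complex.coe_algebraMap, Complex.ofReal_sub, sub_mul, mul_sub,
    Finset.sum_sub_distrib, Complex.real_smul]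
  have h2 : ∑ j, (((if i = j then ∑ k, A i k else 0 : ℝ)) : ℂ) * v j =
      (∑ k, (A i k : ℂ)) * v i := by
    rw [Finset.sum_eq_single i]
    · simp
    · intro j _ hj
      simp [Ne.symm hj]
    · simp
  rw [h2, Finset.sum_mul]
  push_cast
  have h3 : ∀ z : ℂ, (N : ℂ) * (1 / N * z) = z := fun z => by
    rw [← mul_assoc, mul_one_div_cancel hN', one_mul]
  simp only [h3, Finset.mul_sum]
  congr 1
  · exact Finset.sum_congr rfl fun j _ => by ring
  · exact Finset.sum_congr rfl fun j _ => by ring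

/-- The discretization error of the graphon Laplacian on step functions, in terms of the `L¹` error
of the sampled kernel, uniformly over the rows. -/
lemma norm_laplacian_stepEmbedding_sub_le (W : Graphon) {N : ℕ} (hN : 0 < N) {η : ℝ} (hη : 0 ≤ η)
    (h : ∀ x : I, ∫⁻ y : I, edist (W x y)
      (W.detAdjacency N (cellIndex hN x) (cellIndex hN y)) ≤ ENNReal.ofReal η)
    (v : EuclideanSpace ℂ (Fin N)) :
    ‖((N : ℂ) • W.laplacian) (stepEmbedding hN v) - stepEmbedding hN
      (toLpLin 2 2 ((graphLaplacian (W.detAdjacency N)).map (algebraMap ℝ ℂ)) v)‖ ≤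
        N * (√η + η) * ‖v‖ := by
  set L := toLpLin 2 2 ((graphLaplacian (W.detAdjacency N)).map (algebraMap ℝ ℂ)) with hL
  set A := W.detAdjacency N with hA
  set J := stepEmbedding hN with hJ
  set u := stepFunction hN v with hu
  have humem : MemLp u 2 volume := memLp_stepFunction hN v
  have hui : Integrable u := humem.integrable (by norm_num)
  have hunorm : ∫ y, ‖u y‖ ^ 2 = ‖v‖ ^ 2 := by
    rw [← norm_stepEmbedding hN v, sq_norm_Lp_eq_integral]
    refine integral_congr_ae ?_
    filter_upwards [coeFn_stepEmbedding hN v] with x hx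
    rw [hx]
  have key : ∀ᵐ x : I, ‖(((N : ℂ) • W.laplacian) (J v) - J (L v)) x‖ ≤
      N * √η * ‖v‖ + N * η * ‖J v x‖ := by
    filter_upwards [Lp.coeFn_sub (((N : ℂ) • W.laplacian) (J v)) (J (L v)),
      Lp.coeFn_smul (N : ℂ) (W.laplacian (J v)), W.coeFn_laplacian (J v),
      coeFn_stepEmbedding hN v, coeFn_stepEmbedding hN (L v), W.aesm_slice,
      W.integrable_slice hui] with x h1 h2 h3 h4 h5 h6 h7
    have hAm : Measurable fun y : I => (A (cellIndex hN x) (cellIndex hN y) : ℂ) :=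
      (measurable_of_countable fun j => (A (cellIndex hN x) j : ℂ)).comp (measurable_cellIndex hN)
    have hAnorm : ∀ y : I, ‖(A (cellIndex hN x) (cellIndex hN y) : ℂ)‖ ≤ 1 := by
      intro y
      have := detAdjacency_mem_Icc W (cellIndex hN x) (cellIndex hN y)
      rw [Complex.norm_real, Real.norm_of_nonneg this.1]
      exact this.2
    have h8 : Integrable fun y : I => (A (cellIndex hN x) (cellIndex hN y) : ℂ) * (u y - u x) :=
      (hui.sub (integrable_const (u x))).bdd_mul hAm.aestronglyMeasurable (c := 1)
        (Eventually.of_forall hAnorm)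
    set k : I → ℂ := fun y => (W x y : ℂ) - A (cellIndex hN x) (cellIndex hN y) with hk
    have hkm : AEStronglyMeasurable k volume := h6.sub hAm.aestronglyMeasurable
    have hk1 : ∀ y, ‖k y‖ ≤ 1 := by
      intro y
      have ha := detAdjacency_mem_Icc W (cellIndex hN x) (cellIndex hN y)
      have hw := W.mem_Icc x y
      rw [hk]
      simp only
      rw [← Complex.ofReal_sub, Complex.norm_real, Real.norm_eq_abs, abs_le]
      constructor <;> linarith [ha.1, ha.2, hw.1, hw.2]
    have hkmem : MemLp (fun y => ‖k y‖) 2 volume :=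
      MemLp.of_bound hkm.norm 1 (Eventually.of_forall fun y => by simpa using hk1 y)
    have hki : Integrable fun y => ‖k y‖ := hkmem.integrable (by norm_num)
    have hkη : ∫ y, ‖k y‖ ≤ η := by
      rw [integral_norm_eq_lintegral_enorm hkm]
      refine ENNReal.toReal_le_of_le_ofReal hη ((h x).trans' (le_of_eq ?_))
      refine lintegral_congr fun y => ?_
      rw [hk, ← edist_eq_enorm_sub]
      exact Complex.isometry_ofReal.edist_eq _ _
    -- Since `‖k‖ ≤ 1`, the `L¹` bound on a row also bounds its squared `L²` norm; Cauchy–Schwarz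
    -- then produces `√η`.
    have hk2 : ∫ y, ‖k y‖ ^ 2 ≤ η := by
      refine le_trans (integral_mono hkmem.integrable_sq hki fun y => ?_) hkη
      have := hk1 y
      simp only
      nlinarith [norm_nonneg (k y)]
    have hku : ∫ y, ‖k y‖ * ‖u y‖ ≤ √η * ‖v‖ := by
      have := integral_mul_le_Lp_mul_Lq_of_nonneg (μ := (volume : Measure I))
        Real.HolderConjugate.two_two (f := fun y => ‖k y‖) (g := fun y => ‖u y‖)
        (Eventually.of_forall fun y => norm_nonneg _)
        (Eventually.of_forall fun y => norm_nonneg _)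
        (by simpa using hkmem) (by simpa using humem.norm)
      refine this.trans ?_
      simp only [Real.rpow_two, ← Real.sqrt_eq_rpow]
      rw [hunorm, Real.sqrt_sq (norm_nonneg v)]
      gcongr
    have hval : (((N : ℂ) • W.laplacian) (J v) - J (L v)) x = N * ∫ y, k y * (u y - u x) := by
      rw [h1, Pi.sub_apply, h5, stepFunction_graphLaplacian hN A v x]
      have : (((N : ℂ) • W.laplacian) (J v)) x = N * W.laplacianFun u x := by
        have h9 : (((N : ℂ) • W.laplacian) (J v)) x = ((N : ℂ) • W.laplacian (J v)) x := rfl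
        rw [h9, h2, Pi.smul_apply, h3, smul_eq_mul,
          laplacianFun_congr_ae W (coeFn_stepEmbedding hN v) h4]
      rw [this, Graphon.laplacianFun, ← mul_sub, ← integral_sub h7 h8]
      congr 1
      refine integral_congr_ae (Eventually.of_forall fun y => ?_)
      simp only [hk]
      ring
    have hint : ‖∫ y, k y * (u y - u x)‖ ≤ √η * ‖v‖ + η * ‖u x‖ := by
      have hkui : Integrable fun y => ‖k y‖ * ‖u y‖ :=
        hkmem.integrable_mul humem.norm
      calc ‖∫ y, k y * (u y - u x)‖ ≤ ∫ y, (‖k y‖ * ‖u y‖ + ‖k y‖ * ‖u x‖) := by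
            refine norm_integral_le_of_norm_le (hkui.add (hki.mul_const _))
              (Eventually.of_forall fun y => ?_)
            rw [norm_mul, ← mul_add]
            gcongr
            exact norm_sub_le _ _
        _ = (∫ y, ‖k y‖ * ‖u y‖) + (∫ y, ‖k y‖) * ‖u x‖ := by
            rw [integral_add hkui (hki.mul_const _), integral_mul_const]
        _ ≤ _ := by gcongr
    rw [hval, h4, norm_mul, Complex.norm_natCast]
    calc (N : ℝ) * ‖∫ y, k y * (u y - u x)‖ ≤ N * (√η * ‖v‖ + η * ‖u x‖) := by gcongr
      _ = _ := by ring
  refine (norm_Lp_le_of_ae_le (by positivity) (by positivity) key).trans_eq ?_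
  rw [hJ, norm_stepEmbedding]
  ring

end DiscretizationError

/-! ### Uniform sampling error for ring kernels. -/

section RingKernel

open Filter Topology

/-- The oscillation of `R` on the part of the ball of radius `h` around `t` inside `[0, 1]`. -/
noncomputable def ballOscillation (R : ℝ → ℝ) (h t : ℝ) : ENNReal :=
  Metric.ediam (R '' (Metric.ball t h ∩ Icc 0 1))

lemma edist_le_ballOscillation {R : ℝ → ℝ} {h t s s' : ℝ} (hs : |s - t| < h) (hs' : |s' - t| < h)
    (hsI : s ∈ Icc (0 : ℝ) 1) (hsI' : s' ∈ Icc (0 : ℝ) 1) :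
    edist (R s) (R s') ≤ ballOscillation R h t :=
  Metric.edist_le_ediam_of_mem (mem_image_of_mem R ⟨hs, hsI⟩) (mem_image_of_mem R ⟨hs', hsI'⟩)

/-- Because the balls are open, a pair witnessing large oscillation at `t` remains admissible for
nearby centres. The function is thus lower semicontinuous, with no regularity of `R` needed. -/
lemma measurable_ballOscillation (R : ℝ → ℝ) (h : ℝ) : Measurable (ballOscillation R h) := by
  refine LowerSemicontinuous.measurable fun t c hc => ?_
  obtain ⟨s, hs, s', hs', hlt⟩ : ∃ s ∈ Metric.ball t h ∩ Icc 0 1,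
      ∃ s' ∈ Metric.ball t h ∩ Icc 0 1, c < edist (R s) (R s') := by
    by_contra! hle
    refine absurd hc (not_lt.2 (Metric.ediam_le ?_))
    rintro _ ⟨s, hs, rfl⟩ _ ⟨s', hs', rfl⟩
    exact hle s hs s' hs'
  have h1 : ∀ᶠ t' in 𝓝 t, dist s t' < h :=
    (continuous_const.dist continuous_id).continuousAt.eventually_lt_const hs.1
  have h2 : ∀ᶠ t' in 𝓝 t, dist s' t' < h :=
    (continuous_const.dist continuous_id).continuousAt.eventually_lt_const hs'.1
  filter_upwards [h1, h2] with t' ht1 ht2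
  exact hlt.trans_le (edist_le_ballOscillation ht1 ht2 hs.2 hs'.2)

lemma ballOscillation_le_one {R : ℝ → ℝ} (hR : ∀ z, R z ∈ Icc (0 : ℝ) 1) (h t : ℝ) :
    ballOscillation R h t ≤ 1 := by
  refine Metric.ediam_le ?_
  rintro _ ⟨s, -, rfl⟩ _ ⟨s', -, rfl⟩
  rw [edist_dist, ← ENNReal.ofReal_one]
  refine ENNReal.ofReal_le_ofReal ?_
  rw [Real.dist_eq, abs_le]
  constructor <;> linarith [(hR s).1, (hR s).2, (hR s').1, (hR s').2]

lemma tendsto_ballOscillation {R : ℝ → ℝ} {t : ℝ} (hRt : ContinuousWithinAt R (Icc 0 1) t)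
    {h : ℕ → ℝ} (hh : Tendsto h atTop (𝓝 0)) :
    Tendsto (fun n => ballOscillation R (h n) t) atTop (𝓝 0) := by
  rw [ENNReal.tendsto_nhds_zero]
  intro ε hε
  have hball := hRt (Metric.eball_mem_nhds (R t) (ENNReal.half_pos hε.ne'))
  rw [mem_map, Metric.mem_nhdsWithin_iff] at hball
  obtain ⟨d, hd, hsub⟩ := hball
  filter_upwards [hh.eventually_lt_const hd] with n hn
  refine Metric.ediam_le ?_
  rintro _ ⟨s, hs, rfl⟩ _ ⟨s', hs', rfl⟩
  have h1 : edist (R s) (R t) < ε / 2 := hsub ⟨Metric.ball_subset_ball hn.le hs.1, hs.2⟩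
  have h2 : edist (R s') (R t) < ε / 2 := hsub ⟨Metric.ball_subset_ball hn.le hs'.1, hs'.2⟩
  calc edist (R s) (R s') ≤ edist (R s) (R t) + edist (R s') (R t) := edist_triangle_right _ _ _
    _ ≤ ε / 2 + ε / 2 := add_le_add h1.le h2.le
    _ = ε := ENNReal.add_halves ε

/-- Continuity of the kernel at a point gives continuity of the profile. -/
lemma continuousWithinAt_of_continuousAt {W : Graphon} {R : ℝ → ℝ}
    (hW : ∀ x y : I, W x y = R |(x : ℝ) - y|) {x y : I} (hxy : (x : ℝ) < y) (hy : (y : ℝ) < 1)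
    (hc : ContinuousAt (fun q : I × I => W q.1 q.2) (x, y)) :
    ContinuousWithinAt R (Icc 0 1) ((y : ℝ) - x) := by
  -- Along this slice `W` reads off `R t`; `y < 1` keeps the clipping inactive near `y - x`.
  set s : ℝ → I × I := fun t => (x, projIcc 0 1 zero_le_one (x + t)) with hs
  have hsc : Continuous s := by
    refine continuous_const.prodMk (continuous_projIcc.comp (by fun_prop))
  have hs0 : s ((y : ℝ) - x) = (x, y) := by
    simp [hs]
  have hcomp : ContinuousAt (fun t => W (s t).1 (s t).2) ((y : ℝ) - x) :=
    ContinuousAt.comp (g := fun q : I × I => W q.1 q.2) (by rw [hs0]; exact hc) hsc.continuousAt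
  have hev : ∀ᶠ t in 𝓝[Icc 0 1] ((y : ℝ) - x), R t = W (s t).1 (s t).2 := by
    have h1 : ∀ᶠ t in 𝓝[Icc 0 1] ((y : ℝ) - x), (x : ℝ) + t < 1 := by
      have hadd : ContinuousAt (fun t : ℝ => (x : ℝ) + t) ((y : ℝ) - x) := by fun_prop
      exact nhdsWithin_le_nhds (Tendsto.eventually_lt_const (by linarith) hadd)
    filter_upwards [h1, self_mem_nhdsWithin] with t ht htI
    have hmem : (x : ℝ) + t ∈ Icc (0 : ℝ) 1 := ⟨by linarith [x.2.1, htI.1], ht.le⟩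
    simp only [hs]
    rw [hW, projIcc_of_mem zero_le_one hmem]
    simp [abs_of_nonneg htI.1]
  refine (hcomp.continuousWithinAt).congr_of_eventuallyEq hev ?_
  rw [hs0, hW, abs_sub_comm, abs_of_pos (by linarith)]

/-- The profile of an almost everywhere continuous ring graphon is almost everywhere continuous. -/
lemma ae_continuousWithinAt_profile {W : Graphon} (hWc : W.IsAEContinuous) {R : ℝ → ℝ}
    (hW : ∀ x y : I, W x y = R |(x : ℝ) - y|) :
    ∀ᵐ t ∂(volume.restrict (Icc (0 : ℝ) 1)), ContinuousWithinAt R (Icc 0 1) t := by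
  have hprod : ∀ᵐ x : I, ∀ᵐ y : I, ContinuousAt (fun q : I × I => W q.1 q.2) (x, y) :=
    Measure.ae_ae_of_ae_prod hWc
  -- A good row `x` determines the profile almost everywhere on `(0, 1 - x)`; rows tending to `0`
  -- exhaust `(0, 1)`.
  have hex : ∀ n : ℕ, ∃ x : I, (x : ℝ) < 1 / ((n : ℝ) + 1) ∧
      ∀ᵐ y : I, ContinuousAt (fun q : I × I => W q.1 q.2) (x, y) := by
    intro n
    by_contra! hno
    have hn0 : (0 : ℝ) < 1 / ((n : ℝ) + 1) := by positivity
    have hn1 : 1 / ((n : ℝ) + 1) ≤ 1 := by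
      rw [div_le_one (by positivity)]
      linarith [(Nat.cast_nonneg n : (0 : ℝ) ≤ n)]
    let q : I := ⟨1 / ((n : ℝ) + 1), hn0.le, hn1⟩
    have hnull : volume (Iio q) = 0 := by
      refine measure_mono_null (fun x hx => ?_) hprod
      exact not_eventually.2 (hno x hx)
    rw [unitInterval.volume_Iio, ENNReal.ofReal_eq_zero] at hnull
    exact absurd hnull (not_le.2 hn0)
  choose x hx1 hx2 using hex
  have hshift : ∀ n, ∀ᵐ t : ℝ, 0 < t → t + x n < 1 → ContinuousWithinAt R (Icc 0 1) t := by
    intro n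
    have h1 : ∀ᵐ y : ℝ, y ∈ Icc (0 : ℝ) 1 → (x n : ℝ) < y → y < 1 →
        ContinuousWithinAt R (Icc 0 1) (y - x n) := by
      rw [← ae_restrict_iff' measurableSet_Icc, ← unitInterval.measurePreserving_coe.map_eq,
        unitInterval.measurableEmbedding_coe.ae_map_iff]
      filter_upwards [hx2 n] with y hy hxy hy1
      exact continuousWithinAt_of_continuousAt hW hxy hy1 hy
    have h2 := (measurePreserving_add_right (volume : Measure ℝ)
      (x n : ℝ)).quasiMeasurePreserving.ae h1
    filter_upwards [h2] with t ht ht0 ht1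
    have := ht ⟨by linarith [(x n).2.1], ht1.le⟩ (by linarith) ht1
    rwa [add_sub_cancel_right] at this
  have h0 : ∀ᵐ t : ℝ, t ≠ 0 := by
    rw [ae_iff]
    simp
  have h1 : ∀ᵐ t : ℝ, t ≠ 1 := by
    rw [ae_iff]
    simp
  rw [ae_restrict_iff' measurableSet_Icc]
  filter_upwards [ae_all_iff.2 hshift, h0, h1] with t ht ht0 ht1 htI
  have hlt : t < 1 := lt_of_le_of_ne htI.2 ht1
  obtain ⟨n, hn⟩ := exists_nat_one_div_lt (sub_pos.2 hlt)
  exact ht n (lt_of_le_of_ne htI.1 (Ne.symm ht0)) (by linarith [hx1 n])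

/-- A bound for the sampling error of a ring kernel in terms of the distance of the points. -/
noncomputable def samplingError (R : ℝ → ℝ) (h t : ℝ) : ENNReal :=
  ballOscillation R h t + (Metric.ball 0 h).indicator 1 t

lemma measurable_samplingError (R : ℝ → ℝ) (h : ℝ) : Measurable (samplingError R h) :=
  (measurable_ballOscillation R h).add (measurable_one.indicator Metric.isOpen_ball.measurableSet)

lemma tendsto_lintegral_samplingError {R : ℝ → ℝ} (hR : ∀ z, R z ∈ Icc (0 : ℝ) 1)
    (hc : ∀ᵐ t ∂(volume.restrict (Icc (0 : ℝ) 1)), ContinuousWithinAt R (Icc 0 1) t)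
    {h : ℕ → ℝ} (hh : Tendsto h atTop (𝓝 0)) :
    Tendsto (fun n => ∫⁻ t in Icc (0 : ℝ) 1, samplingError R (h n) t) atTop (𝓝 0) := by
  have hlim := tendsto_lintegral_of_dominated_convergence (μ := volume.restrict (Icc (0 : ℝ) 1))
    (F := fun n t => samplingError R (h n) t) (f := fun _ => 0) (fun _ => 2)
    (fun n => measurable_samplingError R (h n)) (fun n => Eventually.of_forall fun t => ?_)
    (by simp) ?_
  · simpa using hlim
  · calc samplingError R (h n) t ≤ 1 + 1 := by
          refine add_le_add (ballOscillation_le_one hR _ _) (indicator_le_self' ?_ t)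
          simp
      _ = 2 := one_add_one_eq_two
  · have h0 : ∀ᵐ t ∂(volume.restrict (Icc (0 : ℝ) 1)), t ≠ 0 := by
      refine ae_restrict_of_ae ?_
      rw [ae_iff]
      simp
    filter_upwards [hc, h0] with t ht ht0
    have h1 := tendsto_ballOscillation ht hh
    have h2 : Tendsto (fun n => (Metric.ball 0 (h n)).indicator (1 : ℝ → ENNReal) t) atTop
        (𝓝 0) := by
      refine tendsto_const_nhds.congr' ?_
      filter_upwards [hh.eventually_lt_const (norm_pos_iff.2 ht0)] with n hn
      rw [indicator_of_notMem]
      rw [mem_ball_zero_iff]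
      exact hn.not_gt
    simpa [samplingError] using h1.add h2

/-- The map `y ↦ |x - y|` folds `[0,1]` at most two to one onto itself. This is what makes the row
estimate independent of `x`. -/
lemma lintegral_abs_sub_le {F : ℝ → ENNReal} (hF : Measurable F) (x : I) :
    ∫⁻ y : I, F |(x : ℝ) - y| ≤ 2 * ∫⁻ t in Icc (0 : ℝ) 1, F t := by
  set G := (Icc (0 : ℝ) 1).indicator F with hG
  have hGm : Measurable G := hF.indicator measurableSet_Icc
  have hGint : ∫⁻ t, G t = ∫⁻ t in Icc (0 : ℝ) 1, F t := lintegral_indicator measurableSet_Icc F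
  calc ∫⁻ y : I, F |(x : ℝ) - y| ≤ ∫⁻ y : I, (G ((x : ℝ) - y) + G (y - x)) := by
        refine lintegral_mono fun y => ?_
        rcases le_total (x : ℝ) y with hxy | hxy
        · have hmem : (y : ℝ) - x ∈ Icc (0 : ℝ) 1 :=
            ⟨by linarith, by linarith [x.2.1, y.2.2]⟩
          refine le_trans (le_of_eq ?_) le_add_self
          rw [hG, indicator_of_mem hmem, abs_sub_comm, abs_of_nonneg hmem.1]
        · have hmem : (x : ℝ) - y ∈ Icc (0 : ℝ) 1 :=
            ⟨by linarith, by linarith [y.2.1, x.2.2]⟩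
          refine le_trans (le_of_eq ?_) le_self_add
          rw [hG, indicator_of_mem hmem, abs_of_nonneg hmem.1]
    _ = ∫⁻ y in Icc (0 : ℝ) 1, (G ((x : ℝ) - y) + G (y - x)) :=
        lintegral_subtype_comap measurableSet_Icc fun y : ℝ => G ((x : ℝ) - y) + G (y - x)
    _ ≤ ∫⁻ y, (G ((x : ℝ) - y) + G (y - x)) := setLIntegral_le_lintegral _ _
    _ = 2 * ∫⁻ t in Icc (0 : ℝ) 1, F t := by
        rw [lintegral_add_left (f := fun y => G ((x : ℝ) - y)) (hGm.comp (by fun_prop)),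
          lintegral_sub_left_eq_self G, lintegral_sub_right_eq_self G, hGint, two_mul]

/-- Moving both points to their grid points changes their distance by at most `2/N`, strictly below
the radius `3/N`. The indicator in `samplingError` pays for the zeroed diagonal cells. -/
lemma edist_detAdjacency_le {W : Graphon} {R : ℝ → ℝ} (hR : ∀ z, R z ∈ Icc (0 : ℝ) 1)
    (hW : ∀ x y : I, W x y = R |(x : ℝ) - y|) {N : ℕ} (hN : 0 < N) (x y : I) :
    edist (W x y) (W.detAdjacency N (cellIndex hN x) (cellIndex hN y)) ≤
      samplingError R (3 / N) |(x : ℝ) - y| := by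
  have hN' : (0 : ℝ) < N := by exact_mod_cast hN
  have hx := abs_le.1 (abs_sub_gridPoint_le hN x)
  have hy := abs_le.1 (abs_sub_gridPoint_le hN y)
  have h3 : (3 : ℝ) / N = 3 * (1 / N) := by ring
  have hpos : 0 < 1 / (N : ℝ) := by positivity
  by_cases hxy : cellIndex hN x = cellIndex hN y
  · have hmem : |(x : ℝ) - y| ∈ Metric.ball (0 : ℝ) (3 / N) := by
      rw [mem_ball_zero_iff, Real.norm_eq_abs, abs_abs, h3, abs_lt]
      rw [hxy] at hx
      constructor <;> linarith [hx.1, hx.2, hy.1, hy.2]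
    refine le_trans ?_ le_add_self
    rw [indicator_of_mem hmem, hxy, hW]
    simp only [Graphon.detAdjacency, Matrix.of_apply, if_true, Pi.one_apply]
    rw [edist_dist, ← ENNReal.ofReal_one]
    refine ENNReal.ofReal_le_ofReal ?_
    rw [Real.dist_eq, sub_zero, abs_of_nonneg (hR _).1]
    exact (hR _).2
  · refine le_trans ?_ le_self_add
    simp only [Graphon.detAdjacency, Matrix.of_apply, if_neg hxy]
    rw [hW, hW]
    have hI : ∀ a b : I, |(a : ℝ) - b| ∈ Icc (0 : ℝ) 1 := fun a b =>
      ⟨abs_nonneg _, abs_le.2 ⟨by linarith [a.2.1, b.2.2], by linarith [a.2.2, b.2.1]⟩⟩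
    refine edist_le_ballOscillation ?_ ?_ (hI _ _) (hI _ _)
    · rw [sub_self, abs_zero]
      positivity
    · refine (abs_abs_sub_abs_le_abs_sub _ _).trans_lt ?_
      rw [h3, abs_lt]
      constructor <;> linarith [hx.1, hx.2, hy.1, hy.2]

/-- For an almost everywhere continuous ring graphon the sampled kernel converges to the kernel in
`L¹`, uniformly over the rows. -/
lemma eventually_lintegral_edist_detAdjacency_le {W : Graphon} (hring : W.IsRing)
    (hWc : W.IsAEContinuous) {η : ℝ} (hη : 0 < η) :
    ∀ᶠ N : ℕ in atTop, ∀ (hN : 0 < N) (x : I), ∫⁻ y : I, edist (W x y)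
      (W.detAdjacency N (cellIndex hN x) (cellIndex hN y)) ≤ ENNReal.ofReal η := by
  obtain ⟨R, -, hR, hW⟩ := hring
  have hh : Tendsto (fun N : ℕ => (3 : ℝ) / N) atTop (𝓝 0) :=
    tendsto_const_div_atTop_nhds_zero_nat 3
  have hlim := tendsto_lintegral_samplingError hR (ae_continuousWithinAt_profile hWc hW) hh
  have hpos : 0 < ENNReal.ofReal (η / 2) := ENNReal.ofReal_pos.2 (half_pos hη)
  filter_upwards [hlim.eventually_le_const hpos] with N h hN x
  calc _ ≤ ∫⁻ y : I, samplingError R (3 / N) |(x : ℝ) - y| :=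
        lintegral_mono fun y => edist_detAdjacency_le hR hW hN x y
    _ ≤ 2 * ∫⁻ t in Icc (0 : ℝ) 1, samplingError R (3 / N) t :=
        lintegral_abs_sub_le (measurable_samplingError R _) x
    _ ≤ 2 * ENNReal.ofReal (η / 2) := by gcongr
    _ = ENNReal.ofReal η := by
        rw [← ENNReal.ofReal_ofNat 2, ← ENNReal.ofReal_mul (by norm_num)]
        congr 1
        ring

end RingKernel

/-! ### Perturbation of eigenvectors and stability of the count. -/

section Perturbation

open Matrix Filter Topology

lemma sq_norm_toLp_real {n : Type*} [Fintype n] (x : n → ℝ) :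
    ‖(WithLp.toLp 2 x : EuclideanSpace ℝ n)‖ ^ 2 = x ⬝ᵥ x := by
  rw [EuclideanSpace.norm_sq_eq]
  simp [dotProduct, sq]

lemma inner_toLp_real {n : Type*} [Fintype n] (x y : n → ℝ) :
    inner ℝ (WithLp.toLp 2 x : EuclideanSpace ℝ n) (WithLp.toLp 2 y) = x ⬝ᵥ y := by
  simp [PiLp.inner_apply, dotProduct, mul_comm]

/-- An operator norm bound for a real matrix passes to its complexification. -/
lemma norm_toLpLin_map_ofReal_le {N : ℕ} {M : Matrix (Fin N) (Fin N) ℝ} {τ : ℝ} (hτ : 0 ≤ τ)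
    (h : ∀ v, (M *ᵥ v) ⬝ᵥ (M *ᵥ v) ≤ τ ^ 2 * (v ⬝ᵥ v)) (v : EuclideanSpace ℂ (Fin N)) :
    ‖toLpLin 2 2 (M.map (algebraMap ℝ ℂ)) v‖ ≤ τ * ‖v‖ := by
  have hsq : ∀ w : EuclideanSpace ℂ (Fin N),
      ‖w‖ ^ 2 = (fun i => (w i).re) ⬝ᵥ (fun i => (w i).re) +
        (fun i => (w i).im) ⬝ᵥ (fun i => (w i).im) := by
    intro w
    rw [EuclideanSpace.norm_sq_eq, dotProduct, dotProduct, ← Finset.sum_add_distrib]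
    refine Finset.sum_congr rfl fun i _ => ?_
    rw [Complex.sq_norm, Complex.normSq_apply]
  have hre : (fun i => (toLpLin 2 2 (M.map (algebraMap ℝ ℂ)) v i).re) =
      M *ᵥ fun i => (v i).re := by
    ext i
    simp [toLpLin_apply, mulVec, dotProduct]
  have him : (fun i => (toLpLin 2 2 (M.map (algebraMap ℝ ℂ)) v i).im) =
      M *ᵥ fun i => (v i).im := by
    ext i
    simp [toLpLin_apply, mulVec, dotProduct]
  refine le_of_sq_le_sq ?_ (by positivity)
  rw [mul_pow, hsq, hsq v, hre, him, mul_add]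
  exact add_le_add (h _) (h _)

/-- A Davis–Kahan theorem: eigenvector matrices of two close symmetric matrices for an isolated
group of eigenvalues agree up to an orthogonal matrix. -/
lemma exists_orthogonal_norm_sub_le_of_isOrthonormalEigenmatrix {N m : ℕ}
    {L L' : Matrix (Fin N) (Fin N) ℝ} (hL' : L'.IsHermitian) {ν r r' τ : ℝ} (hτ : 0 ≤ τ)
    (hcard : (Finset.univ.filter fun i => |hL'.eigenvalues i - ν| < r').card = m)
    {l l' : Fin m → ℝ} {V V' : Matrix (Fin N) (Fin m) ℝ} (hV : IsOrthonormalEigenmatrix L l V)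
    (hV' : IsOrthonormalEigenmatrix L' l' V') (hl : ∀ k, |l k - ν| ≤ r)
    (hl' : ∀ k, |l' k - ν| < r') (hr : r < r')
    (hLL' : ∀ v, ((L' - L) *ᵥ v) ⬝ᵥ ((L' - L) *ᵥ v) ≤ τ ^ 2 * (v ⬝ᵥ v))
    (hsmall : m * (τ / (r' - r)) ^ 2 < 1) :
    ∃ O ∈ Matrix.orthogonalGroup (Fin m) ℝ, ‖V' * O - V‖ ≤ √(2 * m) * (τ / (r' - r)) := by
  have hpos : 0 < r' - r := sub_pos.2 hr
  have hcol : ∀ {V : Matrix (Fin N) (Fin m) ℝ}, Vᵀ * V = 1 → ∀ j k,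
      V.col j ⬝ᵥ V.col k = if j = k then 1 else 0 := by
    intro V hV j k
    have := congrFun (congrFun hV j) k
    rwa [Matrix.one_apply] at this
  set v' : Fin m → EuclideanSpace ℝ (Fin N) := fun k => WithLp.toLp 2 (V'.col k) with hv'
  have horth : Orthonormal ℝ v' := by
    rw [orthonormal_iff_ite]
    intro j k
    rw [hv', inner_toLp_real, hcol hV'.1]
  have heig : ∀ k, toLpLin 2 2 L' (v' k) = ((l' k : ℝ) : ℝ) • v' k := by
    intro k
    rw [hv', toLpLin_apply, hV'.2 k]
    rfl
  refine exists_orthogonal_norm_sub_le hV.1 hV'.1 (by positivity) hsmall fun k => ?_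
  set v : EuclideanSpace ℝ (Fin N) := WithLp.toLp 2 (V.col k) with hv
  have h1 := hL'.isEigenbasis.mul_norm_sub_le hcard horth heig hl' (hl k) hr.le v
  have h2 : toLpLin 2 2 L' v - ((l k : ℝ) : ℝ) • v = WithLp.toLp 2 ((L' - L) *ᵥ V.col k) := by
    rw [hv, toLpLin_apply, sub_mulVec, hV.2 k]
    rfl
  have h3 : ‖toLpLin 2 2 L' v - ((l k : ℝ) : ℝ) • v‖ ≤ τ := by
    refine le_of_sq_le_sq ?_ hτ
    rw [h2, sq_norm_toLp_real]
    refine (hLL' _).trans_eq ?_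
    rw [hcol hV.1, if_pos rfl, mul_one]
  have h4 : ‖v - ∑ j, inner ℝ (v' j) v • v' j‖ ≤ τ / (r' - r) := by
    rw [le_div_iff₀' hpos]
    exact h1.trans h3
  have h5 : ∑ i, (V - V' * (V'ᵀ * V)) i k ^ 2 = ‖v - ∑ j, inner ℝ (v' j) v • v' j‖ ^ 2 := by
    rw [EuclideanSpace.norm_sq_eq]
    refine Finset.sum_congr rfl fun i _ => ?_
    rw [Real.norm_eq_abs, sq_abs]
    congr 1
    have h6 : ∀ j, inner ℝ (v' j) v = (V'ᵀ * V) j k := fun j => inner_toLp_real _ _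
    simp only [Matrix.sub_apply, Matrix.mul_apply (M := V'), PiLp.sub_apply, hv, hv',
      WithLp.ofLp_sum, Finset.sum_apply, PiLp.smul_apply, smul_eq_mul, Matrix.col_apply]
    congr 1
    exact Finset.sum_congr rfl fun j _ => by rw [mul_comm, ← h6]
  rw [h5]
  gcongr

/-- Counting eigenvalues of a symmetric matrix close to the deterministic Laplacian matrix near an
isolated eigenvalue of the graphon Laplacian. -/
lemma Graphon.eventually_card_filter_eq {W : Graphon} (hring : W.IsRing) (hWc : W.IsAEContinuous)
    {μ : ℝ} {E : Submodule ℂ (Lp ℂ 2 (volume : Measure I))}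
    (hE : E = Module.End.eigenspace
      (W.laplacian : Lp ℂ 2 (volume : Measure I) →ₗ[ℂ] Lp ℂ 2 (volume : Measure I)) (μ : ℂ))
    [FiniteDimensional ℂ E] {ε : ℝ} (hε : 0 < ε)
    (hiso : ∀ z ∈ spectrum ℂ W.laplacian, ‖z - μ‖ < ε → z = μ) {r : ℝ} (hr : 0 < r)
    (hrε : r < ε) :
    ∃ ρ > 0, ∀ᶠ N : ℕ in atTop, ∀ L : Matrix (Fin N) (Fin N) ℝ, L.IsHermitian →
      (∀ v, ((L - graphLaplacian (W.detAdjacency N)) *ᵥ v) ⬝ᵥ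
        ((L - graphLaplacian (W.detAdjacency N)) *ᵥ v) ≤ (ρ * N) ^ 2 * (v ⬝ᵥ v)) →
      (L.charpoly.roots.filter fun t => |t / N - μ| < r).card = Module.finrank ℂ E := by
  -- The total error is `2 ρ N`: one share for discretization and one for the perturbation `L`. The
  -- count needs `r + 2ρ < ε` and `4ρ < r`, both ensured by the divisor `5`.
  set ρ := min (ε - r) r / 5 with hρ
  have hmin : 0 < min (ε - r) r := lt_min (sub_pos.2 hrε) hr
  have hρ0 : 0 < ρ := by positivity
  have hρ1 : 5 * ρ ≤ ε - r := by
    have := min_le_left (ε - r) r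
    linarith
  have hρ2 : 5 * ρ ≤ r := by
    have := min_le_right (ε - r) r
    linarith
  set η := min (ρ / 2) ((ρ / 2) ^ 2) with hη
  have hη0 : 0 < η := lt_min (by positivity) (by positivity)
  have hη1 : √η + η ≤ ρ := by
    have h1 : √η ≤ ρ / 2 := Real.sqrt_le_iff.2 ⟨by positivity, min_le_right _ _⟩
    have h2 : η ≤ ρ / 2 := min_le_left _ _
    linarith
  refine ⟨ρ, hρ0, ?_⟩
  filter_upwards [eventually_lintegral_edist_detAdjacency_le hring hWc hη0,
    eventually_norm_le_two_mul_norm_adjoint_stepEmbedding E, eventually_gt_atTop 0] with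
    N h1 h2 hN L hL hclose
  have hN' : (0 : ℝ) < N := by exact_mod_cast hN
  have hLc : (L.map (algebraMap ℝ ℂ)).IsHermitian :=
    hL.map _ fun x => by simp
  rw [card_filter_eigenvalues (hL.roots_charpoly_eq_map_ofReal hLc)]
  set J := stepEmbedding hN with hJ
  set Ld := graphLaplacian (W.detAdjacency N) with hLd
  have herr : ∀ v, ‖((N : ℂ) • W.laplacian) (J v) - J (toLpLin 2 2 (L.map (algebraMap ℝ ℂ)) v)‖ ≤
      N * (2 * ρ) * ‖v‖ := by
    intro v
    have h3 := norm_laplacian_stepEmbedding_sub_le W hN hη0.le (h1 hN) v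
    have h4 := norm_toLpLin_map_ofReal_le (by positivity : 0 ≤ ρ * N) hclose v
    have h5 : ((N : ℂ) • W.laplacian) (J v) - J (toLpLin 2 2 (L.map (algebraMap ℝ ℂ)) v) =
        (((N : ℂ) • W.laplacian) (J v) - J (toLpLin 2 2 (Ld.map (algebraMap ℝ ℂ)) v)) -
          J (toLpLin 2 2 ((L - Ld).map (algebraMap ℝ ℂ)) v) := by
      have h6 : (L - Ld).map (algebraMap ℝ ℂ) =
          L.map (algebraMap ℝ ℂ) - Ld.map (algebraMap ℝ ℂ) :=
        Matrix.map_sub _ (map_sub _) _ _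
      rw [h6, map_sub, LinearMap.sub_apply, map_sub]
      abel
    rw [h5]
    refine (norm_sub_le _ _).trans ?_
    rw [hJ, norm_stepEmbedding]
    refine (add_le_add h3 h4).trans ?_
    have h7 : (N : ℝ) * (√η + η) * ‖v‖ ≤ N * ρ * ‖v‖ := by gcongr
    linarith
  have hT : IsSelfAdjoint ((N : ℂ) • W.laplacian) := by
    refine IsSelfAdjoint.smul ?_ W.isSelfAdjoint_laplacian
    simp [isSelfAdjoint_iff]
  have hcast : ((((N : ℝ) * μ : ℝ)) : ℂ) = (N : ℂ) * μ := by push_cast; rfl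
  have hcount := hLc.isEigenbasis.card_filter_eq (T := (N : ℂ) • W.laplacian) (J := J) (E := E)
    (ν := N * μ) (r := N * r) (g := N * ε) hT (norm_stepEmbedding hN) herr (by positivity)
    (fun f hf => by
      rw [hE, Module.End.mem_eigenspace_iff] at hf
      change (N : ℂ) • W.laplacian f = ((((N : ℝ) * μ : ℝ)) : ℂ) • f
      rw [hcast, mul_smul]
      exact congrArg _ hf)
    (fun f hf => by
      rw [hE] at hf
      have h3 := W.isSelfAdjoint_laplacian.mul_norm_le_norm_apply_sub hε hiso hf
      change (N : ℝ) * ε * ‖f‖ ≤ ‖(N : ℂ) • W.laplacian f - ((((N : ℝ) * μ : ℝ)) : ℂ) • f‖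
      rw [hcast, mul_smul, ← smul_sub, norm_smul, Complex.norm_natCast, mul_assoc]
      gcongr)
    (h2 hN) (by positivity) (by nlinarith) (by nlinarith)
  rw [← hcount]
  congr 1
  refine Finset.filter_congr fun i _ => ?_
  have h3 : hLc.eigenvalues i / N - μ = (hLc.eigenvalues i - N * μ) / N := by
    field_simp
  rw [h3, abs_div, abs_of_pos hN', div_lt_iff₀' hN']

end Perturbation

-- Choice of constants and conclusion.

/- The constant `C` depends on `γ` only; matrices carry the Frobenius norm. -/
theorem mainTheorem2 :
    ∃ C : ℝ → ℝ, (∀ γ ∈ Ioo (0 : ℝ) (1 / 2), 0 < C γ) ∧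
      ∀ (W : Graphon), W.IsRing → W.IsAEContinuous →
      ∀ (μ : ℝ) (m : ℕ), 1 ≤ m → IsIsolatedEigenvalue W.laplacian (μ : ℂ) m →
      ∃ δ₀ : ℝ, 0 < δ₀ ∧ ∀ δ ∈ Ioo (0 : ℝ) δ₀, ∀ γ ∈ Ioo (0 : ℝ) (1 / 2),
      ∃ N₀ : ℕ, 1 ≤ N₀ ∧ ∀ N : ℕ, N₀ ≤ N →
        (∃ l : Fin m → ℝ, IsEigenvalueListNear (graphLaplacian (W.detAdjacency N)) μ δ l) ∧
        ∀ (Ω : Type*) [MeasurableSpace Ω] (P : Measure Ω) [IsProbabilityMeasure P]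
          (A : Ω → Matrix (Fin N) (Fin N) ℝ), W.IsRandomAdjacency P A →
          (1 - 2 * (N : ℝ) * Real.exp (-(C γ * (N : ℝ) ^ (2 * γ))) ≤
            P.real {ω | ∃ l' : Fin m → ℝ,
              IsEigenvalueListNear (graphLaplacian (A ω)) μ δ l'}) ∧
          (∀ l : Fin m → ℝ, IsEigenvalueListNear (graphLaplacian (W.detAdjacency N)) μ δ l →
            1 - 2 * (N : ℝ) * Real.exp (-(C γ * (N : ℝ) ^ (2 * γ))) ≤
              P.real {ω | ∃ l' : Fin m → ℝ,
                IsEigenvalueListNear (graphLaplacian (A ω)) μ δ l' ∧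
                ∀ V V' : Matrix (Fin N) (Fin m) ℝ,
                  IsOrthonormalEigenmatrix (graphLaplacian (W.detAdjacency N)) l V →
                  IsOrthonormalEigenmatrix (graphLaplacian (A ω)) l' V' →
                  ∃ O ∈ Matrix.orthogonalGroup (Fin m) ℝ,
                    ‖V' * O - V‖ ≤
                      √(8 * m) / ((δ₀ - δ) * (N : ℝ) ^ (1 / 2 - γ))}) := by
  classical
  refine ⟨fun _ => 1 / 8, fun _ _ => by norm_num, ?_⟩
  intro W hring hWc μ m _ hμ
  obtain ⟨ε, hε, hiso⟩ := hμ.isolated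
  have hfin := hμ.finiteDimensional
  -- The outer window has radius `ε / 2 < ε`, so counting applies there too. The resulting gap `ε /
  -- 2 - δ` exceeds `ε / 4 - δ`, the quantity in the final bound.
  refine ⟨ε / 4, by positivity, ?_⟩
  rintro δ ⟨hδ0, hδ⟩ γ ⟨hγ0, hγ⟩
  obtain ⟨ρ₁, hρ₁, hcount₁⟩ := Graphon.eventually_card_filter_eq hring hWc rfl hε hiso hδ0
    (by linarith)
  obtain ⟨ρ₂, hρ₂, hcount₂⟩ := Graphon.eventually_card_filter_eq hring hWc rfl hε hiso
    (half_pos hε) (by linarith)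
  rw [hμ.finrank_eq] at hcount₁ hcount₂
  have hgap : 0 < ε / 2 - δ := by linarith
  have hlim : Filter.Tendsto (fun N : ℕ => (N : ℝ) ^ (-(1 / 2 - γ))) Filter.atTop (nhds 0) :=
    (tendsto_rpow_neg_atTop (by linarith)).comp tendsto_natCast_atTop_atTop
  have hlim' : Filter.Tendsto (fun N : ℕ => (m : ℝ) * ((N : ℝ) ^ (-(1 / 2 - γ)) / (ε / 2 - δ)) ^ 2)
      Filter.atTop (nhds 0) := by
    simpa using ((hlim.div_const (ε / 2 - δ)).pow 2).const_mul (m : ℝ)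
  obtain ⟨N₀, hN₀⟩ := Filter.eventually_atTop.1 (hcount₁.and (hcount₂.and
    ((hlim.eventually_le_const hρ₁).and ((hlim.eventually_le_const hρ₂).and
      ((hlim'.eventually_lt_const one_pos).and
        (Graphon.eventually_le_measureReal_opNorm_le hγ0))))))
  refine ⟨max N₀ 1, le_max_right _ _, fun N hN => ?_⟩
  obtain ⟨h₁, h₂, hle₁, hle₂, hsmall, hprob⟩ := hN₀ N (le_of_max_le_left hN)
  have hN' : (0 : ℝ) < N := by exact_mod_cast le_of_max_le_right hN
  have hpow : (N : ℝ) ^ (1 / 2 + γ) = N ^ (-(1 / 2 - γ)) * N := by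
    rw [← Real.rpow_add_one hN'.ne']
    congr 1
    ring
  set Ld := graphLaplacian (W.detAdjacency N) with hLd
  have hLdh : Ld.IsHermitian := isHermitian_graphLaplacian (detAdjacency_symm W)
  refine ⟨exists_isEigenvalueListNear (h₁ Ld hLdh fun v => ?_), ?_⟩
  · rw [sub_self, Matrix.zero_mulVec, dotProduct_zero]
    have := dotProduct_self_nonneg_real v
    positivity
  intro Ω _ P _ A hA
  have hgood := hprob W Ω P A hA
  rw [hpow] at hgood
  have hopen : ∀ {M : Matrix (Fin N) (Fin N) ℝ} {ρ : ℝ}, (N : ℝ) ^ (-(1 / 2 - γ)) ≤ ρ →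
      (∀ v, dotProduct (M.mulVec v) (M.mulVec v) ≤ ((N : ℝ) ^ (-(1 / 2 - γ)) * N) ^ 2 *
        (dotProduct v v)) →
      ∀ v, dotProduct (M.mulVec v) (M.mulVec v) ≤ (ρ * N) ^ 2 * (dotProduct v v) := by
    intro M ρ hρ hM v
    refine (hM v).trans ?_
    have := dotProduct_self_nonneg_real v
    gcongr
  have hherm : ∀ ω, (graphLaplacian (A ω)).IsHermitian := fun ω =>
    isHermitian_graphLaplacian (hA.symm ω)
  -- The same operator norm event serves both probability statements.
  refine ⟨hgood.trans (measureReal_mono fun ω hω => ?_),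
    fun l hl => hgood.trans (measureReal_mono fun ω hω => ?_)⟩
  · exact exists_isEigenvalueListNear (h₁ _ (hherm ω) (hopen hle₁ hω))
  · obtain ⟨l', hl'⟩ := exists_isEigenvalueListNear (h₁ _ (hherm ω) (hopen hle₁ hω))
    refine ⟨l', hl', fun V V' hV hV' => ?_⟩
    have hscale : ∀ {t s : ℝ}, |t / N - μ| < s ↔ |t - N * μ| < N * s := by
      intro t s
      have : t / N - μ = (t - N * μ) / N := by field_simp
      rw [this, abs_div, abs_of_pos hN', div_lt_iff₀' hN']
    -- Both radii contain `m` eigenvalues, so the `m` vectors belonging to the `δ`-window span the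
    -- whole spectral subspace of the larger one.
    have hcard : (Finset.univ.filter fun i =>
        |(hherm ω).eigenvalues i - N * μ| < N * (ε / 2)).card = m := by
      rw [← h₂ _ (hherm ω) (hopen hle₂ hω), card_filter_eigenvalues (hherm ω).roots_charpoly_real]
      simp only [hscale]
    have hθ : (N : ℝ) ^ (-(1 / 2 - γ)) * N / (N * (ε / 2) - N * δ) =
        (N : ℝ) ^ (-(1 / 2 - γ)) / (ε / 2 - δ) := by
      rw [← mul_sub, mul_comm (N : ℝ) (ε / 2 - δ), mul_div_mul_right _ _ hN'.ne']
    obtain ⟨O, hO, hle⟩ := exists_orthogonal_norm_sub_le_of_isOrthonormalEigenmatrix (hherm ω)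
      (by positivity) hcard hV hV' (fun k => (hscale.1 (hl.abs_sub_lt k)).le)
      (fun k => hscale.1 ((hl'.abs_sub_lt k).trans (by linarith)))
      (by nlinarith) hω (by rw [hθ]; exact hsmall)
    refine ⟨O, hO, hle.trans ?_⟩
    have hδ' : 0 < ε / 4 - δ := by linarith
    rw [hθ, Real.rpow_neg hN'.le, inv_eq_one_div, div_div, mul_one_div]
    have hNp : 0 < (N : ℝ) ^ (1 / 2 - γ) := Real.rpow_pos_of_pos hN' _
    rw [mul_comm ((N : ℝ) ^ (1 / 2 - γ))]
    gcongr
    · norm_num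
    · norm_num
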